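/- **Theorem.** If ZF is consistent, then the standard first-order theory $\mathfrak{T}^\infty_0$ is consistent: $\left[\nvdash_{\mathrm{ZF}}\bot\right]\Rightarrow\left[\nvdash_{\mathfrak{T}^\infty_0}\bot\right]$, where $\vdash$ is derivability in classical first-order logic with equality, and ZF is Zermelo–Fraenkel set theory (extensionality, empty set, pairing, union, power set, infinity, regularity, and the separation and replacement schemata) in the language $\{\in\}$. The theory $\mathfrak{T}^\infty_0$ is a theory of sets and functions. Greek variables range over all things; every thing is a set or a function on a set. Roman variables $X, Y, Z, \dots$ (and $f$ in (20)) range over sets. For a set $X$, composite variables $f_X, h_X$ range over the functions on $X$ (a nonempty range). Besides variables there are the constants $\emptyset$, $\omega$, $1_\emptyset$ and the unary function symbol $(\cdot)^+$. The atomic formulas are $t_1=t_2$, $t_1\in t_2$, $t_1:t_2\twoheadrightarrow t_3$ ($t_1$ is a surjection from $t_2$ onto $t_3$) and $t_1:t_2\mapsto t_3$ ($t_1$ maps $t_2$ to $t_3$). The sorts are expressed in one-sorted first-order logic by a predicate "is a set" and a binary predicate "is a function on the set", to which the quantifiers over Roman and composite variables are relativized. The axioms are the following. Set-theoretical axioms: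 1. $\forall X\forall Y(X=Y\Leftrightarrow\forall\alpha(\alpha\in X\Leftrightarrow\alpha\in Y))$ 2. $\forall X\forall f_X\forall Y(f_X\neq Y)$ 3. $\forall X\forall\alpha\forall\beta(X:\alpha\not\twoheadrightarrow\beta\wedge X:\alpha\not\mapsto\beta)$ 4. $\exists X(X=\emptyset\wedge\forall\alpha(\alpha\notin X))$ 5. $\forall\alpha\forall\beta\exists X\forall\gamma(\gamma\in X\Leftrightarrow\gamma=\alpha\vee\gamma=\beta)$ 6. $\forall X\exists Y\forall\alpha(\alpha\in Y\Leftrightarrow\exists Z(Z\in X\wedge\alpha\in Z))$ 7. $\forall X\exists Y\forall\alpha(\alpha\in Y\Leftrightarrow\exists Z(Z\subseteq X\wedge\alpha=Z))$ 8. $\forall X\neq\emptyset\,\exists\alpha(\alpha\in X\wedge\forall\beta(\beta\in\alpha\Rightarrow\beta\notin X))$ 9. $\exists X(X=\omega\wedge\emptyset\in\omega\wedge\forall\alpha(\alpha\in\omega\Rightarrow\alpha^+\in\omega)\wedge\forall\beta\in\omega(\neg\exists\gamma\in\omega(\beta=\gamma^+)\Leftrightarrow\beta=\emptyset))$, where $(\cdot)^+$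 is governed by the axiom $\forall\alpha\forall\beta(\beta=\alpha^+\Leftrightarrow\exists X(\beta=X\wedge\forall\gamma(\gamma\in X\Leftrightarrow\gamma=\alpha)))$ Function-theoretical axioms: 10. $\forall X\forall f_X\forall\alpha(\alpha\notin f_X)$ 11. $\forall X\forall f_X(X\neq\emptyset\Rightarrow\exists Y\exists Z(f_X:Y\twoheadrightarrow Z\wedge\forall\alpha\in Y\,\exists!\beta(f_X:\alpha\mapsto\beta)))$ 12. $\forall X\forall f_X\forall\alpha(\alpha\neq X\Rightarrow\forall\xi(f_X:\alpha\not\twoheadrightarrow\xi))$ 13. $\forall X\forall f_X\forall\alpha\notin X\,\forall\beta(f_X:\alpha\not\mapsto\beta)$ 14. $\forall X\forall f_X(X\neq\emptyset\Rightarrow\forall\beta(f_X:X\twoheadrightarrow\beta\Rightarrow\exists Z(\beta=Z\wedge\forall\gamma(\gamma\in Z\Leftrightarrow\exists\eta\in X(f_X:\eta\mapsto\gamma)))))$ 15. $\forall X\neq\emptyset\,\forall f_X\forall Y(f_X:X\twoheadrightarrow Y\Rightarrow\forall\beta\exists Z\forall\alpha(\alpha\in Z\Leftrightarrow\alpha\in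 X\wedge f_X:\alpha\mapsto\beta))$ 16. $\exists f_\emptyset(f_\emptyset=1_\emptyset\wedge f_\emptyset:\emptyset\twoheadrightarrow\emptyset\wedge\forall\alpha\forall\beta(f_\emptyset:\alpha\not\mapsto\beta))$ 17. $\forall\alpha\forall\beta\exists f_{\alpha^+}(f_{\alpha^+}:\alpha^+\twoheadrightarrow\beta^+\wedge f_{\alpha^+}:\alpha\mapsto\beta)$ 18. $\forall X\forall f_X\forall Y(f_X:X\twoheadrightarrow Y\Rightarrow\forall\alpha(f_X:f_X\not\mapsto\alpha\wedge f_X:\alpha\not\mapsto f_X))$ Schemata, for all formulas $\Phi$, $\Psi$ of the language, with arbitrary parameters over which the instance is universally closed: 19. $\forall X\exists Y\forall\alpha(\alpha\in Y\Leftrightarrow\alpha\in X\wedge\Phi(\alpha))$ and $\forall X(\forall\alpha\in X\,\exists!\beta\,\Psi(\alpha,\beta)\Rightarrow\exists Z\forall\gamma(\gamma\in Z\Leftrightarrow\exists\xi(\xi\in X\wedge\Psi(\xi,\gamma))))$ Reverse graph theorem, taken as an axiom: 20. $\forall f\forall X\forall Y(f\in Y^X\Rightarrow\exists h_X\forall\alpha\forall\beta(h_X:\alpha\mapsto\beta\Leftrightarrow(\alpha,\beta)\in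 f))$ Here $(\alpha,\beta)=\{\alpha,\{\alpha,\beta\}\}$, and $f\in Y^X$ means that $f$ is the graph of a function from $X$ to $Y$: every element of $f$ is a two-tuple $(\alpha,\beta)$ with $\alpha\in X$ and $\beta\in Y$, and for every $\alpha\in X$ there is exactly one $\beta$ with $(\alpha,\beta)\in f$. -/

import Mathlib

namespace SetsAndFunctions

open FirstOrder FirstOrder.Language

/-! ## Classical first-order deduction

Formulas in context have free variables `x₀, x₁, x₂, …`, that is, they are elements of
`L.Formula ℕ`.  The rules are those of classical natural deduction with equality. -/

section Deduction

universe u v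

/-- `inst φ t` is `φ(t)`: the formula `φ` with the term `t` put for its only bound variable in
scope. -/
def inst {L : FirstOrder.Language.{u, v}} (φ : L.BoundedFormula ℕ 1) (t : L.Term ℕ) : L.Formula ℕ :=
  φ.toFormula.subst (Sum.elim Term.var (fun _ => t))

/-- Renames the free variables `x₀, x₁, …` to `x₁, x₂, …`, so that `x₀` becomes fresh. -/
def shift {L : FirstOrder.Language.{u, v}} (φ : L.Formula ℕ) : L.Formula ℕ :=
  φ.relabel Nat.succ

/-- The formula `φ(x₀)`, after the free variables of `φ` have been shifted to make `x₀` fresh. -/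
def instFresh {L : FirstOrder.Language.{u, v}} (φ : L.BoundedFormula ℕ 1) : L.Formula ℕ :=
  φ.toFormula.relabel (Sum.elim Nat.succ (fun _ => 0))

/-- `Derivable Γ φ`: the formula `φ` has a derivation from the hypotheses `Γ` in classical
first-order logic with equality.  (The primitive logical symbols are `⊥`, `=`, `→`, `∀`; the
other connectives abbreviate formulas built from these.) -/
inductive Derivable {L : FirstOrder.Language.{u, v}} : Set (L.Formula ℕ) → L.Formula ℕ → Prop
  | hyp {Γ : Set (L.Formula ℕ)} {φ : L.Formula ℕ} :
      φ ∈ Γ → Derivable Γ φ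
  | impIntro {Γ : Set (L.Formula ℕ)} {φ ψ : L.Formula ℕ} :
      Derivable (insert φ Γ) ψ → Derivable Γ (φ.imp ψ)
  | impElim {Γ : Set (L.Formula ℕ)} {φ ψ : L.Formula ℕ} :
      Derivable Γ (φ.imp ψ) → Derivable Γ φ → Derivable Γ ψ
  | byContra {Γ : Set (L.Formula ℕ)} {φ : L.Formula ℕ} :
      Derivable (insert (φ.imp ⊥) Γ) ⊥ → Derivable Γ φ
  | allIntro {Γ : Set (L.Formula ℕ)} {φ : L.BoundedFormula ℕ 1} :
      Derivable (shift '' Γ) (instFresh φ) → Derivable Γ φ.all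
  | allElim {Γ : Set (L.Formula ℕ)} {φ : L.BoundedFormula ℕ 1} (t : L.Term ℕ) :
      Derivable Γ φ.all → Derivable Γ (inst φ t)
  | eqRefl {Γ : Set (L.Formula ℕ)} (t : L.Term ℕ) :
      Derivable Γ (t.equal t)
  | eqSubst {Γ : Set (L.Formula ℕ)} {s t : L.Term ℕ} (φ : L.BoundedFormula ℕ 1) :
      Derivable Γ (s.equal t) → Derivable Γ (inst φ s) → Derivable Γ (inst φ t)

/-- `T ⊢ σ` for a theory `T` and a sentence `σ`. -/
def Proves {L : FirstOrder.Language.{u, v}} (T : L.Theory) (σ : L.Sentence) : Prop :=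
  Derivable ((fun τ : L.Sentence => Formula.relabel Empty.elim τ) '' T)
    (Formula.relabel Empty.elim σ)

/-- `T ⊬ ⊥`. -/
def Consistent {L : FirstOrder.Language.{u, v}} (T : L.Theory) : Prop :=
  ¬ Proves T ⊥

end Deduction

/-! ## Axiom schemata

In an instance of a schema the formula has parameters `p₀, …, p₍ₘ₋₁₎` (free variables indexed by
`Fin m`) and `j` distinguished variables; the instance is closed by universal quantification over
the parameters.  As everywhere below, `&k` is the variable bound by the quantifier at depth `k`,
counted from the outside and starting from `0`. -/

section Schemata

universe u v

/-- `φ(p, &(w 0), …, &(w (j-1)))`, the formula `φ` with parameters `p` at the given variables. -/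
def at' {L : FirstOrder.Language.{u, v}} {m j d : ℕ} (φ : L.Formula (Fin m ⊕ Fin j)) (w : Fin j → Fin d) :
    L.BoundedFormula (Fin m) d :=
  BoundedFormula.relabel (Sum.map id w) φ

/-- The universal closure `∀ p₀ ⋯ ∀ p₍ₘ₋₁₎ φ(p)`. -/
def closure {L : FirstOrder.Language.{u, v}} {m : ℕ} (φ : L.Formula (Fin m)) : L.Sentence :=
  BoundedFormula.alls (α := Empty) (n := m) (BoundedFormula.relabel Sum.inr φ)

end Schemata

/-! ## Zermelo–Fraenkel set theory -/

section ZF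

/-- The only nonlogical symbol of ZF: the binary relation symbol `∈`. -/
inductive ZFRel : ℕ → Type
  | mem : ZFRel 2

/-- The language of ZF. -/
def LZF : FirstOrder.Language.{0, 0} := ⟨fun _ => Empty, ZFRel⟩

/-- `a ∈ b` in the language of ZF. -/
def zmem {α : Type} {n : ℕ} (a b : LZF.Term (α ⊕ Fin n)) : LZF.BoundedFormula α n :=
  BoundedFormula.rel (L := LZF) ZFRel.mem ![a, b]

local infix:88 " ∈ᶻ " => zmem

/-- `∀ x ∀ y (∀ z (z ∈ x ↔ z ∈ y) → x = y)` -/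
def zfExtensionality : LZF.Sentence :=
  ∀' ∀' ((∀' (&2 ∈ᶻ &0 ⇔ &2 ∈ᶻ &1)) ⟹ &0 =' &1)

/-- `∃ x ∀ y, y ∉ x` -/
def zfEmpty : LZF.Sentence :=
  ∃' ∀' ∼(&1 ∈ᶻ &0)

/-- `∀ x ∀ y ∃ z ∀ w (w ∈ z ↔ w = x ∨ w = y)` -/
def zfPairing : LZF.Sentence :=
  ∀' ∀' ∃' ∀' (&3 ∈ᶻ &2 ⇔ (&3 =' &0 ⊔ &3 =' &1))

/-- `∀ x ∃ y ∀ z (z ∈ y ↔ ∃ w (w ∈ x ∧ z ∈ w))` -/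
def zfUnion : LZF.Sentence :=
  ∀' ∃' ∀' (&2 ∈ᶻ &1 ⇔ ∃' (&3 ∈ᶻ &0 ⊓ &2 ∈ᶻ &3))

/-- `∀ x ∃ y ∀ z (z ∈ y ↔ ∀ w (w ∈ z → w ∈ x))` -/
def zfPower : LZF.Sentence :=
  ∀' ∃' ∀' (&2 ∈ᶻ &1 ⇔ ∀' (&3 ∈ᶻ &2 ⟹ &3 ∈ᶻ &0))

/-- `∃ x (∃ e (∀ y y ∉ e ∧ e ∈ x) ∧ ∀ y (y ∈ x → ∃ z (z ∈ x ∧ ∀ w (w ∈ z ↔ w ∈ y ∨ w = y))))` -/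
def zfInfinity : LZF.Sentence :=
  ∃' ((∃' ((∀' ∼(&2 ∈ᶻ &1)) ⊓ &1 ∈ᶻ &0)) ⊓
    ∀' (&1 ∈ᶻ &0 ⟹ ∃' (&2 ∈ᶻ &0 ⊓ ∀' (&3 ∈ᶻ &2 ⇔ (&3 ∈ᶻ &1 ⊔ &3 =' &1)))))

/-- `∀ x (∃ y (y ∈ x) → ∃ y (y ∈ x ∧ ∀ z (z ∈ y → z ∉ x)))` -/
def zfRegularity : LZF.Sentence :=
  ∀' ((∃' (&1 ∈ᶻ &0)) ⟹ ∃' (&1 ∈ᶻ &0 ⊓ ∀' (&2 ∈ᶻ &1 ⟹ ∼(&2 ∈ᶻ &0))))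

/-- `∀ p ∀ x ∃ y ∀ z (z ∈ y ↔ z ∈ x ∧ φ(p, z))` -/
def zfSeparation {m : ℕ} (φ : LZF.Formula (Fin m ⊕ Fin 1)) : LZF.Sentence :=
  closure (∀' ∃' ∀' (&2 ∈ᶻ &1 ⇔ (&2 ∈ᶻ &0 ⊓ at' φ ![2])))

/-- `∀ p ∀ x (∀ y (y ∈ x → ∃! z ψ(p, y, z)) → ∃ z ∀ w (w ∈ z ↔ ∃ y (y ∈ x ∧ ψ(p, y, w))))` -/
def zfReplacement {m : ℕ} (ψ : LZF.Formula (Fin m ⊕ Fin 2)) : LZF.Sentence :=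
  closure (∀' ((∀' (&1 ∈ᶻ &0 ⟹ ∃' (at' ψ ![1, 2] ⊓ ∀' (at' ψ ![1, 3] ⟹ &3 =' &2)))) ⟹
    ∃' ∀' (&2 ∈ᶻ &1 ⇔ ∃' (&3 ∈ᶻ &0 ⊓ at' ψ ![3, 2]))))

/-- Zermelo–Fraenkel set theory (without the axiom of choice). -/
def ZF : LZF.Theory :=
  {zfExtensionality, zfEmpty, zfPairing, zfUnion, zfPower, zfInfinity, zfRegularity} ∪
  {σ | ∃ (m : ℕ) (φ : LZF.Formula (Fin m ⊕ Fin 1)), σ = zfSeparation φ} ∪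
  {σ | ∃ (m : ℕ) (ψ : LZF.Formula (Fin m ⊕ Fin 2)), σ = zfReplacement ψ}

end ZF

/-! ## The theory of sets and functions

The theory has variables of several sorts: Greek variables range over all things, Roman variables
over sets and, for a set `X`, composite variables `f_X` over the functions on `X`.  As usual, sorts
are expressed by relation symbols: `isSet x` says that `x` is a set, `isFun f X` that `f` is a
function on the set `X`, and quantifiers over Roman and composite variables are relativized to
these. -/

section SetFun

/-- The function symbols: the constants `∅`, `ω`, `1_∅` and the unary symbol `(·)⁺`. -/
inductive TFunc : ℕ → Type
  | empty : TFunc 0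
  | omega : TFunc 0
  | inactive : TFunc 0
  | plus : TFunc 1

/-- The relation symbols: the sorts, membership `a ∈ b`, `f : a ↠ b`, and `f : a ↦ b`. -/
inductive TRel : ℕ → Type
  | isSet : TRel 1
  | isFun : TRel 2
  | mem : TRel 2
  | onto : TRel 3
  | maps : TRel 3

/-- The language of the theory of sets and functions. -/
def LT : FirstOrder.Language.{0, 0} := ⟨TFunc, TRel⟩

variable {α : Type} {n : ℕ}

/-- The constant `∅`. -/
def emp : LT.Term (α ⊕ Fin n) := Term.func (L := LT) TFunc.empty ![]

/-- The constant `ω`. -/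
def omg : LT.Term (α ⊕ Fin n) := Term.func (L := LT) TFunc.omega ![]

/-- The constant `1_∅`. -/
def one : LT.Term (α ⊕ Fin n) := Term.func (L := LT) TFunc.inactive ![]

/-- The term `t⁺`. -/
def plus (t : LT.Term (α ⊕ Fin n)) : LT.Term (α ⊕ Fin n) := Term.func (L := LT) TFunc.plus ![t]

/-- `t` is a set. -/
def isSet (t : LT.Term (α ⊕ Fin n)) : LT.BoundedFormula α n :=
  BoundedFormula.rel (L := LT) TRel.isSet ![t]

/-- `f` is a function on the set `X`. -/
def isFun (f X : LT.Term (α ⊕ Fin n)) : LT.BoundedFormula α n :=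
  BoundedFormula.rel (L := LT) TRel.isFun ![f, X]

/-- `a ∈ b` -/
def tmem (a b : LT.Term (α ⊕ Fin n)) : LT.BoundedFormula α n :=
  BoundedFormula.rel (L := LT) TRel.mem ![a, b]

/-- `f : a ↠ b` -/
def onto (f a b : LT.Term (α ⊕ Fin n)) : LT.BoundedFormula α n :=
  BoundedFormula.rel (L := LT) TRel.onto ![f, a, b]

/-- `f : a ↦ b` -/
def maps (f a b : LT.Term (α ⊕ Fin n)) : LT.BoundedFormula α n :=
  BoundedFormula.rel (L := LT) TRel.maps ![f, a, b]

local infix:88 " ∈ᵗ " => tmem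

/-- The term `t`, read under one more quantifier. -/
def up (t : LT.Term (α ⊕ Fin n)) : LT.Term (α ⊕ Fin (n + 1)) :=
  t.relabel (Sum.map id Fin.castSucc)

/-- The variable bound by the innermost quantifier. -/
def new : LT.Term (α ⊕ Fin (n + 1)) := Term.var (Sum.inr (Fin.last n))

/-- `∀ X φ` for a Roman variable `X`. -/
def allSet (φ : LT.BoundedFormula α (n + 1)) : LT.BoundedFormula α n :=
  ∀' (isSet new ⟹ φ)

/-- `∃ X φ` for a Roman variable `X`. -/
def exSet (φ : LT.BoundedFormula α (n + 1)) : LT.BoundedFormula α n :=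
  ∃' (isSet new ⊓ φ)

/-- `∀ f_X φ` for a composite variable `f_X`. -/
def allFun (X : LT.Term (α ⊕ Fin n)) (φ : LT.BoundedFormula α (n + 1)) :
    LT.BoundedFormula α n :=
  ∀' (isFun new (up X) ⟹ φ)

/-- `∃ f_X φ` for a composite variable `f_X`. -/
def exFun (X : LT.Term (α ⊕ Fin n)) (φ : LT.BoundedFormula α (n + 1)) :
    LT.BoundedFormula α n :=
  ∃' (isFun new (up X) ⊓ φ)

/-- `∀ ξ ∈ X φ` for a Greek variable `ξ`. -/
def allIn (X : LT.Term (α ⊕ Fin n)) (φ : LT.BoundedFormula α (n + 1)) :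
    LT.BoundedFormula α n :=
  ∀' (new ∈ᵗ up X ⟹ φ)

/-- `∃ ξ ∈ X φ` for a Greek variable `ξ`. -/
def exIn (X : LT.Term (α ⊕ Fin n)) (φ : LT.BoundedFormula α (n + 1)) :
    LT.BoundedFormula α n :=
  ∃' (new ∈ᵗ up X ⊓ φ)

/-! ### Conventions on the sorts -/

/-- Every thing is a set or a function on a set. -/
def sortThing : LT.Sentence :=
  ∀' (isSet &0 ⊔ exSet (isFun &0 &1))

/-- Composite variables have a set as subscript. -/
def sortFun : LT.Sentence :=
  ∀' ∀' (isFun &0 &1 ⟹ isSet &1)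

/-- The range of a composite variable is nonempty. -/
def sortNonempty : LT.Sentence :=
  allSet (exFun &0 (&1 =' &1))

/-! ### Set-theoretical axioms -/

/-- `∀ X ∀ Y (X = Y ⇔ ∀ α (α ∈ X ⇔ α ∈ Y))` -/
def axExt : LT.Sentence :=
  allSet (allSet (&0 =' &1 ⇔ ∀' (&2 ∈ᵗ &0 ⇔ &2 ∈ᵗ &1)))

/-- `∀ X ∀ f_X ∀ Y (f_X ≠ Y)` -/
def axFunNotSet : LT.Sentence :=
  allSet (allFun &0 (allSet ∼(&1 =' &2)))

/-- `∀ X ∀ α ∀ β (¬ X : α ↠ β ∧ ¬ X : α ↦ β)` -/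
def axSetNotFun : LT.Sentence :=
  allSet (∀' ∀' (∼(onto &0 &1 &2) ⊓ ∼(maps &0 &1 &2)))

/-- `∃ X (X = ∅ ∧ ∀ α (α ∉ X))` -/
def axEmpty : LT.Sentence :=
  exSet (&0 =' emp ⊓ ∀' ∼(&1 ∈ᵗ &0))

/-- `∀ α ∀ β ∃ X ∀ γ (γ ∈ X ⇔ γ = α ∨ γ = β)` -/
def axPair : LT.Sentence :=
  ∀' ∀' (exSet (∀' (&3 ∈ᵗ &2 ⇔ (&3 =' &0 ⊔ &3 =' &1))))

/-- `∀ X ∃ Y ∀ α (α ∈ Y ⇔ ∃ Z (Z ∈ X ∧ α ∈ Z))` -/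
def axUnion : LT.Sentence :=
  allSet (exSet (∀' (&2 ∈ᵗ &1 ⇔ exSet (&3 ∈ᵗ &0 ⊓ &2 ∈ᵗ &3))))

/-- `∀ X ∃ Y ∀ α (α ∈ Y ⇔ ∃ Z (Z ⊆ X ∧ α = Z))` -/
def axPower : LT.Sentence :=
  allSet (exSet (∀' (&2 ∈ᵗ &1 ⇔ exSet ((∀' (&4 ∈ᵗ &3 ⟹ &4 ∈ᵗ &0)) ⊓ &2 =' &3))))

/-- `∀ X ≠ ∅ ∃ α (α ∈ X ∧ ∀ β (β ∈ α ⇒ β ∉ X))` -/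
def axRegularity : LT.Sentence :=
  allSet (∼(&0 =' emp) ⟹ ∃' (&1 ∈ᵗ &0 ⊓ ∀' (&2 ∈ᵗ &1 ⟹ ∼(&2 ∈ᵗ &0))))

/-- `∃ X (X = ω ∧ ∅ ∈ ω ∧ ∀ α (α ∈ ω ⇒ α⁺ ∈ ω) ∧ ∀ β ∈ ω (¬ ∃ γ ∈ ω (β = γ⁺) ⇔ β = ∅))` -/
def axInfinity : LT.Sentence :=
  exSet (&0 =' omg ⊓ emp ∈ᵗ omg ⊓ (∀' (&1 ∈ᵗ omg ⟹ plus &1 ∈ᵗ omg)) ⊓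
    allIn omg (∼(exIn omg (&1 =' plus &2)) ⇔ &1 =' emp))

/-- `∀ α ∀ β (β = α⁺ ⇔ ∃ X (β = X ∧ ∀ γ (γ ∈ X ⇔ γ = α)))` -/
def axPlus : LT.Sentence :=
  ∀' ∀' (&1 =' plus &0 ⇔ exSet (&1 =' &2 ⊓ ∀' (&3 ∈ᵗ &2 ⇔ &3 =' &0)))

/-! ### Function-theoretical axioms -/

/-- `∀ X ∀ f_X ∀ α (α ∉ f_X)` -/
def axFunNoElem : LT.Sentence :=
  allSet (allFun &0 (∀' ∼(&2 ∈ᵗ &1)))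

/-- `∀ X ∀ f_X (X ≠ ∅ ⇒ ∃ Y ∃ Z (f_X : Y ↠ Z ∧ ∀ α ∈ Y ∃! β (f_X : α ↦ β)))` -/
def axFunTotal : LT.Sentence :=
  allSet (allFun &0 (∼(&0 =' emp) ⟹ exSet (exSet (onto &1 &2 &3 ⊓
    allIn &2 (∃' (maps &1 &4 &5 ⊓ ∀' (maps &1 &4 &6 ⟹ &6 =' &5)))))))

/-- `∀ X ∀ f_X ∀ α (α ≠ X ⇒ ∀ ξ (¬ f_X : α ↠ ξ))` -/
def axFunDomain : LT.Sentence :=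
  allSet (allFun &0 (∀' (∼(&2 =' &0) ⟹ ∀' ∼(onto &1 &2 &3))))

/-- `∀ X ∀ f_X ∀ α ∉ X ∀ β (¬ f_X : α ↦ β)` -/
def axFunOutside : LT.Sentence :=
  allSet (allFun &0 (∀' (∼(&2 ∈ᵗ &0) ⟹ ∀' ∼(maps &1 &2 &3))))

/-- `∀ X ∀ f_X (X ≠ ∅ ⇒ ∀ β (f_X : X ↠ β ⇒`
`∃ Z (β = Z ∧ ∀ γ (γ ∈ Z ⇔ ∃ η ∈ X (f_X : η ↦ γ)))))` -/
def axFunRange : LT.Sentence :=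
  allSet (allFun &0 (∼(&0 =' emp) ⟹ ∀' (onto &1 &0 &2 ⟹
    exSet (&2 =' &3 ⊓ ∀' (&4 ∈ᵗ &3 ⇔ exIn &0 (maps &1 &5 &4))))))

/-- `∀ X ≠ ∅ ∀ f_X ∀ Y (f_X : X ↠ Y ⇒ ∀ β ∃ Z ∀ α (α ∈ Z ⇔ α ∈ X ∧ f_X : α ↦ β))` -/
def axFunPreimage : LT.Sentence :=
  allSet (∼(&0 =' emp) ⟹ allFun &0 (allSet (onto &1 &0 &2 ⟹
    ∀' (exSet (∀' (&5 ∈ᵗ &4 ⇔ (&5 ∈ᵗ &0 ⊓ maps &1 &5 &3)))))))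

/-- `∃ f_∅ (f_∅ = 1_∅ ∧ f_∅ : ∅ ↠ ∅ ∧ ∀ α ∀ β (¬ f_∅ : α ↦ β))` -/
def axInactive : LT.Sentence :=
  exFun emp (&0 =' one ⊓ onto &0 emp emp ⊓ ∀' ∀' ∼(maps &0 &1 &2))

/-- `∀ α ∀ β ∃ f_{α⁺} (f_{α⁺} : α⁺ ↠ β⁺ ∧ f_{α⁺} : α ↦ β)` -/
def axUrFunction : LT.Sentence :=
  ∀' ∀' (exFun (plus &0) (onto &2 (plus &0) (plus &1) ⊓ maps &2 &0 &1))

/-- `∀ X ∀ f_X ∀ Y (f_X : X ↠ Y ⇒ ∀ α (¬ f_X : f_X ↦ α ∧ ¬ f_X : α ↦ f_X))` -/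
def axFunRegularity : LT.Sentence :=
  allSet (allFun &0 (allSet (onto &1 &0 &2 ⟹
    ∀' (∼(maps &1 &1 &3) ⊓ ∼(maps &1 &3 &1)))))

/-! ### Separation, replacement, and the reverse graph theorem -/

/-- `∀ p ∀ X ∃ Y ∀ α (α ∈ Y ⇔ α ∈ X ∧ φ(p, α))` -/
def separation {m : ℕ} (φ : LT.Formula (Fin m ⊕ Fin 1)) : LT.Sentence :=
  closure (allSet (exSet (∀' (&2 ∈ᵗ &1 ⇔ (&2 ∈ᵗ &0 ⊓ at' φ ![2])))))

/-- `∀ p ∀ X (∀ α ∈ X ∃! β ψ(p, α, β) ⇒ ∃ Z ∀ γ (γ ∈ Z ⇔ ∃ ξ (ξ ∈ X ∧ ψ(p, ξ, γ))))` -/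
def replacement {m : ℕ} (ψ : LT.Formula (Fin m ⊕ Fin 2)) : LT.Sentence :=
  closure (allSet (allIn &0 (∃' (at' ψ ![1, 2] ⊓ ∀' (at' ψ ![1, 3] ⟹ &3 =' &2))) ⟹
    exSet (∀' (&2 ∈ᵗ &1 ⇔ ∃' (&3 ∈ᵗ &0 ⊓ at' ψ ![3, 2])))))

/-- `p` is the set `{a, b}`. -/
def isPair (p a b : LT.Term (α ⊕ Fin n)) : LT.BoundedFormula α n :=
  isSet p ⊓ ∀' (new ∈ᵗ up p ⇔ (new =' up a ⊔ new =' up b))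

/-- `p` is the two-tuple `(a, b) = {a, {a, b}}`. -/
def isTuple (p a b : LT.Term (α ⊕ Fin n)) : LT.BoundedFormula α n :=
  ∃' (isPair new (up a) (up b) ⊓ isPair (up p) (up a) new)

/-- `(a, b) ∈ f` -/
def tupleMem (a b f : LT.Term (α ⊕ Fin n)) : LT.BoundedFormula α n :=
  ∃' (isTuple new (up a) (up b) ⊓ new ∈ᵗ up f)

/-- `f ∈ Y^X`, that is, `f` is the graph of a function from `X` to `Y`: each element of `f` is a
two-tuple `(α, β)` with `α ∈ X` and `β ∈ Y`, and for each `α ∈ X` there is exactly one `β` with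
`(α, β) ∈ f`. -/
def isGraph (f X Y : LT.Term (α ⊕ Fin n)) : LT.BoundedFormula α n :=
  allIn f (exIn (up X) (exIn (up (up Y)) (isTuple (up (up new)) (up new) new))) ⊓
  allIn X (∃' (tupleMem (up new) new (up (up f)) ⊓
    ∀' (tupleMem (up (up new)) new (up (up (up f))) ⟹ new =' up new)))

/-- `∀ f ∀ X ∀ Y (f ∈ Y^X ⇒ ∃ h_X ∀ α ∀ β (h_X : α ↦ β ⇔ (α, β) ∈ f))` -/
def reverseGraph : LT.Sentence :=
  allSet (allSet (allSet (isGraph &0 &1 &2 ⟹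
    exFun &1 (∀' ∀' (maps &3 &4 &5 ⇔ tupleMem &4 &5 &0)))))

/-- The theory `𝔗^∞_0`: the standard axioms of the theory of sets and functions, the separation
and replacement schemata, and the reverse graph theorem. -/
def TInfty0 : LT.Theory :=
  {sortThing, sortFun, sortNonempty} ∪
  {axExt, axFunNotSet, axSetNotFun, axEmpty, axPair, axUnion, axPower, axRegularity, axInfinity,
    axPlus} ∪
  {axFunNoElem, axFunTotal, axFunDomain, axFunOutside, axFunRange, axFunPreimage, axInactive,
    axUrFunction, axFunRegularity} ∪
  {σ | ∃ (m : ℕ) (φ : LT.Formula (Fin m ⊕ Fin 1)), σ = separation φ} ∪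
  {σ | ∃ (m : ℕ) (ψ : LT.Formula (Fin m ⊕ Fin 2)), σ = replacement ψ} ∪
  {reverseGraph}

end SetFun

end SetsAndFunctions

/-!
By completeness, ZF has a model `M`, and by soundness it suffices to turn the carrier of `M` into a
model of the theory of sets and functions. To make room for things that are not sets, a set `x` is
represented by its von Neumann successor `x ∪ {x}`; a function with graph `F` is then coded by the
singleton of the representative of `F`, and by regularity such a singleton is never a successor.
Everything that is neither a set nor the code of a function serves as a function on the empty set.
All of this is definable in `M`, so each instance of separation or replacement for the new language
follows from one for ZF.
-/

namespace SetsAndFunctions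

open FirstOrder FirstOrder.Language

/-! ## Renaming of variables -/

section Renaming

universe u v
variable {L : FirstOrder.Language.{u, v}} {α β γ : Type*}

/-- The renaming `ρ` carried under one more quantifier, whose variable it fixes. -/
def liftRen {n m : ℕ} (ρ : α ⊕ Fin n → β ⊕ Fin m) : α ⊕ Fin (n + 1) → β ⊕ Fin (m + 1) :=
  Sum.elim (fun a => Sum.map id Fin.castSucc (ρ (Sum.inl a)))
    (Fin.lastCases (Sum.inr (Fin.last m)) fun j => Sum.map id Fin.castSucc (ρ (Sum.inr j)))

@[simp] theorem liftRen_inl {n m : ℕ} (ρ : α ⊕ Fin n → β ⊕ Fin m) (a : α) :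
    liftRen ρ (Sum.inl a) = Sum.map id Fin.castSucc (ρ (Sum.inl a)) := rfl

@[simp] theorem liftRen_last {n m : ℕ} (ρ : α ⊕ Fin n → β ⊕ Fin m) :
    liftRen ρ (Sum.inr (Fin.last n)) = Sum.inr (Fin.last m) := by
  simp [liftRen]

@[simp] theorem liftRen_castSucc {n m : ℕ} (ρ : α ⊕ Fin n → β ⊕ Fin m) (j : Fin n) :
    liftRen ρ (Sum.inr j.castSucc) = Sum.map id Fin.castSucc (ρ (Sum.inr j)) := by
  simp [liftRen]

theorem renaming_ext {n : ℕ} {ρ τ : α ⊕ Fin (n + 1) → β}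
    (hl : ∀ a, ρ (Sum.inl a) = τ (Sum.inl a))
    (hlast : ρ (Sum.inr (Fin.last n)) = τ (Sum.inr (Fin.last n)))
    (hr : ∀ j : Fin n, ρ (Sum.inr j.castSucc) = τ (Sum.inr j.castSucc)) : ρ = τ := by
  funext x
  rcases x with a | i
  · exact hl a
  · exact Fin.lastCases hlast hr i

theorem liftRen_map_castSucc {n m : ℕ} (τ : α ⊕ Fin n → β ⊕ Fin m) (y : α ⊕ Fin n) :
    liftRen τ (Sum.map id Fin.castSucc y) = Sum.map id Fin.castSucc (τ y) := by
  rcases y with a | j <;> simp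

theorem liftRen_comp {n m k : ℕ} (τ : β ⊕ Fin m → γ ⊕ Fin k) (ρ : α ⊕ Fin n → β ⊕ Fin m) :
    liftRen (τ ∘ ρ) = liftRen τ ∘ liftRen ρ :=
  renaming_ext (by simp [liftRen_map_castSucc]) (by simp) (by simp [liftRen_map_castSucc])

@[simp] theorem liftRen_sumMap {n : ℕ} (f : α → β) :
    liftRen (Sum.map f id : α ⊕ Fin n → β ⊕ Fin n) = Sum.map f id :=
  renaming_ext (by simp) (by simp) (by simp)

/-- The formula `φ` with its free variables, and the variables bound in its scope, renamed along
`ρ`. Unlike `BoundedFormula.relabel` and `BoundedFormula.subst` it may exchange variables of the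
two kinds, so that it subsumes `inst`, `shift` and `instFresh`. -/
def rename : ∀ {n : ℕ}, L.BoundedFormula α n → ∀ {m : ℕ}, (α ⊕ Fin n → β ⊕ Fin m) →
    L.BoundedFormula β m
  | _, .falsum, _, _ => .falsum
  | _, .equal s t, _, ρ => .equal (s.relabel ρ) (t.relabel ρ)
  | _, .rel R ts, _, ρ => .rel R fun i => (ts i).relabel ρ
  | _, .imp φ ψ, _, ρ => .imp (rename φ ρ) (rename ψ ρ)
  | _, .all φ, _, ρ => .all (rename φ (liftRen ρ))

theorem rename_rename {n m k : ℕ} (φ : L.BoundedFormula α n) (ρ : α ⊕ Fin n → β ⊕ Fin m)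
    (τ : β ⊕ Fin m → γ ⊕ Fin k) : rename (rename φ ρ) τ = rename φ (τ ∘ ρ) := by
  induction φ generalizing m k with
  | falsum => rfl
  | equal s t => simp only [rename, Term.relabel_relabel]
  | rel R ts => simp only [rename, Term.relabel_relabel]
  | imp φ ψ ihφ ihψ => simp only [rename, ihφ, ihψ]
  | all φ ih => simp only [rename, ih, liftRen_comp]

theorem relabel_congr {t : L.Term (α ⊕ β)} [DecidableEq α] {f g : α ⊕ β → γ}
    (hl : ∀ a ∈ t.varFinsetLeft, f (Sum.inl a) = g (Sum.inl a))
    (hr : ∀ b, f (Sum.inr b) = g (Sum.inr b)) : t.relabel f = t.relabel g := by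
  induction t with
  | var x =>
    rcases x with a | b
    · exact congrArg Term.var (hl a (Finset.mem_singleton_self a))
    · exact congrArg Term.var (hr b)
  | func F ts ih =>
    exact congrArg (Term.func F) <| funext fun i =>
      ih i fun a ha => hl a (Finset.mem_biUnion.2 ⟨i, Finset.mem_univ i, ha⟩)

theorem rename_congr [DecidableEq α] {n m : ℕ} {φ : L.BoundedFormula α n}
    {ρ τ : α ⊕ Fin n → β ⊕ Fin m}
    (hl : ∀ a ∈ φ.freeVarFinset, ρ (Sum.inl a) = τ (Sum.inl a))
    (hr : ∀ i, ρ (Sum.inr i) = τ (Sum.inr i)) : rename φ ρ = rename φ τ := by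
  induction φ generalizing m with
  | falsum => rfl
  | equal s t =>
    exact congrArg₂ BoundedFormula.equal
      (relabel_congr (fun a ha => hl a (Finset.mem_union_left _ ha)) hr)
      (relabel_congr (fun a ha => hl a (Finset.mem_union_right _ ha)) hr)
  | rel R ts =>
    exact congrArg (BoundedFormula.rel R) <| funext fun i =>
      relabel_congr (fun a ha => hl a (Finset.mem_biUnion.2 ⟨i, Finset.mem_univ i, ha⟩)) hr
  | imp φ ψ ihφ ihψ =>
    exact congrArg₂ BoundedFormula.imp
      (ihφ (fun a ha => hl a (Finset.mem_union_left _ ha)) hr)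
      (ihψ (fun a ha => hl a (Finset.mem_union_right _ ha)) hr)
  | all φ ih =>
    refine congrArg BoundedFormula.all (ih (fun a ha => ?_) fun i => ?_)
    · rw [liftRen_inl, liftRen_inl, hl a ha]
    · refine Fin.lastCases ?_ (fun j => ?_) i
      · rw [liftRen_last, liftRen_last]
      · rw [liftRen_castSucc, liftRen_castSucc, hr j]

theorem liftRen_relabelAux {n k : ℕ} (g : α → β ⊕ Fin n) :
    liftRen (BoundedFormula.relabelAux g k) = BoundedFormula.relabelAux g (k + 1) := by
  refine renaming_ext (fun a => ?_) ?_ fun j => ?_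
  · rcases h : g a with b | j
    · simp [BoundedFormula.relabelAux, h]
    · simp only [liftRen_inl, BoundedFormula.relabelAux, Function.comp_apply, Sum.map_inl, h]
      rfl
  all_goals simp [BoundedFormula.relabelAux]

theorem boundedFormula_relabel_eq_rename {n k : ℕ} (g : α → β ⊕ Fin n)
    (φ : L.BoundedFormula α k) : φ.relabel g = rename φ (BoundedFormula.relabelAux g k) := by
  induction φ with
  | falsum => rfl
  | equal s t => rfl
  | rel R ts => rfl
  | imp φ ψ ihφ ihψ => rw [BoundedFormula.relabel_imp, ihφ, ihψ, rename]
  | all φ ih =>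
    rw [BoundedFormula.relabel_all, ih, ← liftRen_relabelAux]
    rfl

theorem relabel_eq_rename (f : α → β) (φ : L.Formula α) :
    φ.relabel f = rename φ (Sum.map f id) := by
  refine (boundedFormula_relabel_eq_rename _ _).trans (congrArg _ (funext fun x => ?_))
  rcases x with a | i
  · rfl
  · exact i.elim0

theorem toFormula_eq_rename {n : ℕ} (φ : L.BoundedFormula α n) :
    φ.toFormula = rename φ (Sum.inl : α ⊕ Fin n → (α ⊕ Fin n) ⊕ Fin 0) := by
  induction φ with
  | falsum => rfl
  | equal s t => rfl
  | rel R ts => rfl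
  | imp φ ψ ihφ ihψ => simp only [BoundedFormula.toFormula, rename, ihφ, ihψ]
  | @all n φ ih =>
    simp only [BoundedFormula.toFormula, rename, ih]
    refine congrArg BoundedFormula.all <| (boundedFormula_relabel_eq_rename _ _).trans <|
      (rename_rename _ _ _).trans <| congrArg _ <|
      renaming_ext (fun a => rfl) ?_ fun j => ?_
    · simp only [Function.comp_apply, BoundedFormula.relabelAux, Sum.map_inl, Sum.elim_inr,
        finSumFinEquiv_symm_last, liftRen_last]
      rfl
    · simp [BoundedFormula.relabelAux]

theorem subst_var_eq_rename {n : ℕ} (φ : L.BoundedFormula α n) (f : α → β) :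
    φ.subst (fun a => Term.var (f a)) = rename φ (Sum.map f id) := by
  have term_subst : ∀ {n : ℕ} (t : L.Term (α ⊕ Fin n)),
      t.subst (Sum.elim (Term.relabel Sum.inl ∘ fun a => Term.var (f a)) (Term.var ∘ Sum.inr))
        = t.relabel (Sum.map f id) := by
    intro n t
    induction t with
    | var x => rcases x with a | i <;> rfl
    | func F ts ih => simp only [Term.subst, Term.relabel, ih]
  induction φ with
  | falsum => rfl
  | equal s t =>
    simp only [BoundedFormula.subst, BoundedFormula.mapTermRel, rename, term_subst]
  | rel R ts =>
    simp only [BoundedFormula.subst, BoundedFormula.mapTermRel, rename, term_subst, id]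
  | imp φ ψ ihφ ihψ => simp only [rename, ← ihφ, ← ihψ]; rfl
  | all φ ih => simp only [rename, liftRen_sumMap, ← ih]; rfl

theorem inst_var_eq_rename (φ : L.BoundedFormula ℕ 1) (k : ℕ) :
    inst φ (Term.var k) = rename φ (Sum.elim Sum.inl fun _ => Sum.inl k) := by
  have var_comp : (Sum.elim Term.var fun _ => Term.var k : ℕ ⊕ Fin 1 → L.Term ℕ)
      = fun a => Term.var (Sum.elim id (fun _ => k) a) := by
    funext x; rcases x with a | i <;> rfl
  rw [inst, var_comp, subst_var_eq_rename, toFormula_eq_rename, rename_rename]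
  congr 1
  funext x; rcases x with a | i <;> rfl

theorem inst_rename_liftRen {n : ℕ} (φ : L.BoundedFormula α (n + 1)) (ρ : α ⊕ Fin n → ℕ) (k : ℕ) :
    inst (rename φ (liftRen (Sum.inl ∘ ρ) : α ⊕ Fin (n + 1) → ℕ ⊕ Fin 1)) (Term.var k)
      = rename φ
        (Sum.inl ∘ Sum.elim (ρ ∘ Sum.inl) (Fin.lastCases k fun j => ρ (Sum.inr j))) := by
  rw [inst_var_eq_rename, rename_rename]
  exact congrArg _ (renaming_ext (by simp) (by simp) (by simp))

theorem rename_inst (φ : L.BoundedFormula ℕ 1) (k : ℕ) (f : ℕ → ℕ) :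
    rename (inst φ (Term.var k)) (Sum.map f id)
      = inst (rename φ (Sum.map f id)) (Term.var (f k)) := by
  rw [inst_var_eq_rename, inst_var_eq_rename, rename_rename, rename_rename]
  congr 1
  funext x; rcases x with a | i <;> rfl

theorem instFresh_eq_inst (φ : L.BoundedFormula ℕ 1) :
    instFresh φ = inst (rename φ (Sum.map Nat.succ id)) (Term.var 0) := by
  rw [instFresh, relabel_eq_rename, toFormula_eq_rename, rename_rename, inst_var_eq_rename,
    rename_rename]
  congr 1
  funext x; rcases x with a | i <;> rfl

theorem rename_equal (s t : L.Term α) (f : α → β) :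
    rename (s.equal t) (Sum.map f id : α ⊕ Fin 0 → β ⊕ Fin 0)
      = (s.relabel f).equal (t.relabel f) := by
  simp only [Term.equal, Term.bdEqual, rename, Term.relabel_relabel]
  rfl

/-- The renaming that fixes `x₀` and acts as `f` on the shifted variables `x₁, x₂, …`. -/
def underFresh (f : ℕ → ℕ) : ℕ → ℕ := fun k => Nat.casesOn k 0 fun k => f k + 1

theorem rename_underFresh_rename_succ {n : ℕ} (φ : L.BoundedFormula ℕ n) (f : ℕ → ℕ) :
    rename (rename φ (Sum.map Nat.succ id)) (Sum.map (underFresh f) (id : Fin n → Fin n))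
      = rename (rename φ (Sum.map f id)) (Sum.map Nat.succ id) := by
  rw [rename_rename, rename_rename]
  congr 1
  funext x; rcases x with a | i <;> rfl

theorem rename_instFresh (φ : L.BoundedFormula ℕ 1) (f : ℕ → ℕ) :
    rename (instFresh φ) (Sum.map (underFresh f) id) = instFresh (rename φ (Sum.map f id)) := by
  rw [instFresh_eq_inst, instFresh_eq_inst, rename_inst, rename_underFresh_rename_succ]
  rfl

theorem rename_shift (φ : L.Formula ℕ) (f : ℕ → ℕ) :
    rename (shift φ) (Sum.map (underFresh f) id) = shift (rename φ (Sum.map f id)) := by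
  rw [shift, shift, relabel_eq_rename, relabel_eq_rename, rename_underFresh_rename_succ]

/-- The variable `x_k` does not occur freely in `φ`; more precisely, what becomes of `φ` under a
renaming does not depend on what becomes of `x_k`. -/
def IsFresh (k : ℕ) {n : ℕ} (φ : L.BoundedFormula ℕ n) : Prop :=
  ∀ f g : ℕ → ℕ, (∀ i ≠ k, f i = g i) →
    rename φ (Sum.map f (id : Fin n → Fin n)) = rename φ (Sum.map g id)

theorem eventually_isFresh {n : ℕ} (φ : L.BoundedFormula ℕ n) :
    ∀ᶠ k in Filter.cofinite, IsFresh k φ := by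
  filter_upwards [φ.freeVarFinset.eventually_cofinite_notMem] with k hk f g hfg
  exact rename_congr (fun a ha => congrArg Sum.inl (hfg a (ne_of_mem_of_not_mem ha hk)))
    fun _ => rfl

theorem relabel_sentence_eq_rename (σ : L.Sentence) {m : ℕ} (ρ : Empty ⊕ Fin 0 → ℕ ⊕ Fin m)
    (τ : ℕ ⊕ Fin 0 → ℕ ⊕ Fin m) : rename (Formula.relabel Empty.elim σ) τ = rename σ ρ := by
  rw [relabel_eq_rename, rename_rename]
  exact congrArg _ (Subsingleton.elim _ _)

theorem isFresh_sentence (k : ℕ) (σ : L.Sentence) :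
    IsFresh k (Formula.relabel Empty.elim σ : L.Formula ℕ) := fun f g _ => by
  rw [relabel_sentence_eq_rename σ (Sum.map Empty.elim id), relabel_sentence_eq_rename]

end Renaming

/-! ## Structural properties of derivability -/

section Structural

universe u v
variable {L : FirstOrder.Language.{u, v}} {Γ Δ : Set (L.Formula ℕ)} {φ ψ : L.Formula ℕ}

theorem Derivable.mono (h : Derivable Γ φ) (hΔ : Γ ⊆ Δ) : Derivable Δ φ := by
  induction h generalizing Δ with
  | hyp h => exact .hyp (hΔ h)
  | impIntro _ ih => exact .impIntro (ih (Set.insert_subset_insert hΔ))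
  | impElim _ _ ih₁ ih₂ => exact .impElim (ih₁ hΔ) (ih₂ hΔ)
  | byContra _ ih => exact .byContra (ih (Set.insert_subset_insert hΔ))
  | allIntro _ ih => exact .allIntro (ih (Set.image_mono hΔ))
  | allElim t _ ih => exact .allElim t (ih hΔ)
  | eqRefl t => exact .eqRefl t
  | eqSubst φ _ _ ih₁ ih₂ => exact .eqSubst φ (ih₁ hΔ) (ih₂ hΔ)

theorem Derivable.cut (hψ : Derivable (insert φ Γ) ψ) (hφ : Derivable Γ φ) : Derivable Γ ψ :=
  .impElim (.impIntro hψ) hφ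

theorem Derivable.exfalso (h : Derivable Γ ⊥) : Derivable Γ φ :=
  .byContra (h.mono (Set.subset_insert _ _))

theorem exists_finite_derivable_insert
    (h : ∃ Δ ⊆ insert φ Γ, Δ.Finite ∧ Derivable Δ ψ) :
    ∃ Δ ⊆ Γ, Δ.Finite ∧ Derivable (insert φ Δ) ψ := by
  obtain ⟨Δ, hΔ, hfin, hψ⟩ := h
  exact ⟨Δ \ {φ}, by simpa [Set.sdiff_subset_iff] using hΔ, hfin.sdiff, hψ.mono (by simp)⟩

theorem Derivable.exists_finite (h : Derivable Γ φ) : ∃ Δ ⊆ Γ, Δ.Finite ∧ Derivable Δ φ := by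
  induction h with
  | hyp h => exact ⟨_, Set.singleton_subset_iff.2 h, Set.finite_singleton _, .hyp rfl⟩
  | impIntro _ ih =>
    obtain ⟨Δ, hΔ, hfin, h⟩ := exists_finite_derivable_insert ih
    exact ⟨Δ, hΔ, hfin, .impIntro h⟩
  | impElim _ _ ih₁ ih₂ =>
    obtain ⟨Δ₁, hΔ₁, hfin₁, h₁⟩ := ih₁
    obtain ⟨Δ₂, hΔ₂, hfin₂, h₂⟩ := ih₂
    exact ⟨_, Set.union_subset hΔ₁ hΔ₂, hfin₁.union hfin₂,
      .impElim (h₁.mono Set.subset_union_left) (h₂.mono Set.subset_union_right)⟩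
  | byContra _ ih =>
    obtain ⟨Δ, hΔ, hfin, h⟩ := exists_finite_derivable_insert ih
    exact ⟨Δ, hΔ, hfin, .byContra h⟩
  | allIntro _ ih =>
    obtain ⟨Δ, hΔ, hfin, h⟩ := ih
    obtain ⟨Δ', hΔ', hfin', rfl⟩ := Set.exists_subset_image_finite_and.1 ⟨Δ, hΔ, hfin, rfl⟩
    exact ⟨Δ', hΔ', hfin', .allIntro h⟩
  | allElim t _ ih =>
    obtain ⟨Δ, hΔ, hfin, h⟩ := ih
    exact ⟨Δ, hΔ, hfin, .allElim t h⟩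
  | eqRefl t => exact ⟨∅, Set.empty_subset _, Set.finite_empty, .eqRefl t⟩
  | eqSubst φ _ _ ih₁ ih₂ =>
    obtain ⟨Δ₁, hΔ₁, hfin₁, h₁⟩ := ih₁
    obtain ⟨Δ₂, hΔ₂, hfin₂, h₂⟩ := ih₂
    exact ⟨_, Set.union_subset hΔ₁ hΔ₂, hfin₁.union hfin₂,
      .eqSubst φ (h₁.mono Set.subset_union_left) (h₂.mono Set.subset_union_right)⟩

variable [L.IsRelational]

theorem exists_eq_var {α : Type*} (t : L.Term α) : ∃ a, t = Term.var a := by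
  cases t with
  | var a => exact ⟨a, rfl⟩
  | func F _ => exact isEmptyElim F

theorem Derivable.rename (h : Derivable Γ φ) (f : ℕ → ℕ) :
    Derivable ((SetsAndFunctions.rename · (Sum.map f id)) '' Γ)
      (SetsAndFunctions.rename φ (Sum.map f id) : L.Formula ℕ) := by
  induction h generalizing f with
  | hyp h => exact .hyp (Set.mem_image_of_mem _ h)
  | impIntro _ ih =>
    have hf := ih f
    rw [Set.image_insert_eq] at hf
    exact .impIntro hf
  | impElim _ _ ih₁ ih₂ => exact .impElim (ih₁ f) (ih₂ f)
  | byContra _ ih =>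
    have hf := ih f
    rw [Set.image_insert_eq] at hf
    exact .byContra hf
  | allIntro _ ih =>
    have hf := ih (underFresh f)
    simp only [rename_instFresh, Set.image_image, rename_shift] at hf
    simp only [SetsAndFunctions.rename, liftRen_sumMap]
    refine .allIntro ?_
    rwa [Set.image_image]
  | allElim t _ ih =>
    obtain ⟨k, rfl⟩ := exists_eq_var t
    have hf := ih f
    simp only [SetsAndFunctions.rename, liftRen_sumMap] at hf
    rw [rename_inst]
    exact .allElim _ hf
  | eqRefl t => rw [rename_equal]; exact .eqRefl _
  | @eqSubst _ s t φ _ _ ih₁ ih₂ =>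
    obtain ⟨j, rfl⟩ := exists_eq_var s
    obtain ⟨k, rfl⟩ := exists_eq_var t
    have heq := ih₁ f
    have hinst := ih₂ f
    rw [rename_equal] at heq
    simp only [rename_inst] at hinst
    rw [rename_inst]
    exact .eqSubst (s := .var (f j)) (t := .var (f k)) _ heq hinst

theorem Derivable.all_of_isFresh {φ : L.BoundedFormula ℕ 1} {k : ℕ} (hΓ : ∀ ψ ∈ Γ, IsFresh k ψ)
    (hφ : IsFresh k φ) (h : Derivable Γ (inst φ (Term.var k))) : Derivable Γ φ.all := by
  have hf := h.rename (Function.update Nat.succ k 0)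
  have hsucc : ∀ i ≠ k, Function.update Nat.succ k 0 i = i.succ := fun i hi =>
    Function.update_of_ne hi _ _
  rw [rename_inst, Function.update_self, hφ _ _ hsucc, ← instFresh_eq_inst] at hf
  refine .allIntro ?_
  convert hf using 1
  refine Set.image_congr fun ψ hψ => ?_
  rw [shift, relabel_eq_rename, hΓ ψ hψ _ _ hsucc]

end Structural

/-! ## Completeness for countable relational languages -/

section Completeness

universe u v
variable {L : FirstOrder.Language.{u, v}} {Γ : Set (L.Formula ℕ)}

/-- A maximal consistent set of formulas in which every false universal statement has a variable
as a counterexample. -/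
structure IsHenkin (Γ : Set (L.Formula ℕ)) : Prop where
  consistent : ¬ Derivable Γ ⊥
  complete : ∀ φ : L.Formula ℕ, φ ∈ Γ ∨ φ.imp ⊥ ∈ Γ
  witness : ∀ ψ : L.BoundedFormula ℕ 1, (ψ.all.imp ⊥ : L.Formula ℕ) ∈ Γ →
    ∃ k : ℕ, (inst ψ (Term.var k)).imp ⊥ ∈ Γ

/-- A stage in the construction of a Henkin set: a consistent set of formulas that leaves almost
all variables fresh, so that witnesses can be added to it. -/
structure IsStage (Γ : Set (L.Formula ℕ)) : Prop where
  consistent : ¬ Derivable Γ ⊥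
  fresh : ∀ᶠ k in Filter.cofinite, ∀ ψ ∈ Γ, IsFresh k ψ

theorem IsStage.insert (h : IsStage Γ) {φ : L.Formula ℕ} (hφ : ¬ Derivable (insert φ Γ) ⊥) :
    IsStage (insert φ Γ) := by
  refine ⟨hφ, ?_⟩
  filter_upwards [h.fresh, eventually_isFresh φ] with k hΓ hk
  exact Set.forall_mem_insert.2 ⟨hk, hΓ⟩

theorem IsStage.exists_decided (h : IsStage Γ) (φ : L.Formula ℕ) :
    ∃ Γ' ⊇ Γ, IsStage Γ' ∧ (φ ∈ Γ' ∨ φ.imp ⊥ ∈ Γ') := by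
  by_cases hφ : Derivable (Insert.insert φ Γ) ⊥
  · have hn : ¬ Derivable (Insert.insert (φ.imp ⊥) Γ) ⊥ := fun hn =>
      h.consistent (hφ.cut (.byContra hn))
    exact ⟨_, Set.subset_insert _ _, h.insert hn, .inr (Set.mem_insert _ _)⟩
  · exact ⟨_, Set.subset_insert _ _, h.insert hφ, .inl (Set.mem_insert _ _)⟩

theorem not_derivable_iUnion_of_monotone {G : ℕ → Set (L.Formula ℕ)} (hG : Monotone G)
    (h : ∀ n, ¬ Derivable (G n) ⊥) : ¬ Derivable (⋃ n, G n) ⊥ := by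
  intro hd
  obtain ⟨Δ, hΔ, hfin, hd⟩ := hd.exists_finite
  obtain ⟨n, hn⟩ := hG.directed_le.exists_mem_subset_of_finset_subset_biUnion
    (s := hfin.toFinset) (by simpa using hΔ)
  exact h n (hd.mono (by simpa using hn))

section Relational

variable [L.IsRelational]

theorem IsStage.exists_witness_of_mem (h : IsStage Γ) {ψ : L.BoundedFormula ℕ 1}
    (hψ : (ψ.all.imp ⊥ : L.Formula ℕ) ∈ Γ) :
    ∃ k : ℕ, IsStage (Insert.insert ((inst ψ (Term.var k)).imp ⊥) Γ) := by
  obtain ⟨k, hΓ, hk⟩ := (h.fresh.and (eventually_isFresh ψ)).exists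
  exact ⟨k, h.insert fun hn =>
    h.consistent (.impElim (.hyp hψ) (Derivable.all_of_isFresh hΓ hk (.byContra hn)))⟩

theorem IsStage.exists_witnessed (h : IsStage Γ) (φ : L.Formula ℕ) :
    ∃ Γ' ⊇ Γ, IsStage Γ' ∧ ∀ ψ : L.BoundedFormula ℕ 1, φ = ψ.all.imp ⊥ → φ ∈ Γ →
      ∃ k : ℕ, (inst ψ (Term.var k)).imp ⊥ ∈ Γ' := by
  by_cases hφ : ∃ ψ : L.BoundedFormula ℕ 1, φ = ψ.all.imp ⊥ ∧ φ ∈ Γ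
  · obtain ⟨ψ, rfl, hψ⟩ := hφ
    obtain ⟨k, hk⟩ := h.exists_witness_of_mem hψ
    refine ⟨_, Set.subset_insert _ _, hk, fun ψ' hψ' _ => ⟨k, ?_⟩⟩
    obtain rfl : ψ = ψ' := by injection hψ' with _ hall; injection hall
    exact Set.mem_insert _ _
  · exact ⟨Γ, subset_rfl, h, fun ψ hψ hm => absurd ⟨ψ, hψ, hm⟩ hφ⟩

theorem IsStage.exists_step (h : IsStage Γ) (φ : L.Formula ℕ) :
    ∃ Γ' ⊇ Γ, IsStage Γ' ∧ (φ ∈ Γ' ∨ φ.imp ⊥ ∈ Γ') ∧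
      ∀ ψ : L.BoundedFormula ℕ 1, φ = ψ.all.imp ⊥ → φ ∈ Γ' →
        ∃ k : ℕ, (inst ψ (Term.var k)).imp ⊥ ∈ Γ' := by
  obtain ⟨Γ₁, hΓ₁, h₁, hφ⟩ := h.exists_decided φ
  obtain ⟨Γ₂, hΓ₂, h₂, hwit⟩ := h₁.exists_witnessed φ
  refine ⟨Γ₂, hΓ₁.trans hΓ₂, h₂, hφ.imp (@hΓ₂ _) (@hΓ₂ _), fun ψ hψ hm => hwit ψ hψ ?_⟩
  exact hφ.resolve_right fun hn => h₂.consistent (.impElim (.hyp (hΓ₂ hn)) (.hyp hm))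

theorem IsStage.exists_isHenkin [Countable L.Symbols] (h : IsStage Γ) :
    ∃ Δ ⊇ Γ, IsHenkin Δ := by
  obtain ⟨e, he⟩ := exists_surjective_nat (L.Formula ℕ)
  choose next hsub hstage hdec hwit using
    fun (Γ : {Γ : Set (L.Formula ℕ) // IsStage Γ}) φ => Γ.2.exists_step φ
  let G : ℕ → {Γ : Set (L.Formula ℕ) // IsStage Γ} := fun n =>
    Nat.rec ⟨Γ, h⟩ (fun n Γ => ⟨next Γ (e n), hstage Γ (e n)⟩) n
  have hle : ∀ n, (G n).1 ⊆ ⋃ n, (G n).1 := Set.subset_iUnion fun n => (G n).1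
  have hcon : ¬ Derivable (⋃ n, (G n).1) ⊥ :=
    not_derivable_iUnion_of_monotone (monotone_nat_of_le_succ fun n => hsub (G n) (e n))
      fun n => (G n).2.consistent
  have hcomplete : ∀ n, e n ∈ (G (n + 1)).1 ∨ (e n).imp ⊥ ∈ (G (n + 1)).1 := fun n =>
    hdec (G n) (e n)
  refine ⟨⋃ n, (G n).1, hle 0, hcon, fun φ => ?_, fun ψ hψ => ?_⟩
  · obtain ⟨n, rfl⟩ := he φ
    exact (hcomplete n).imp (@hle (n + 1) _) (@hle (n + 1) _)
  · obtain ⟨n, hn⟩ := he (ψ.all.imp ⊥)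
    rw [← hn] at hψ
    have hmem : e n ∈ (G (n + 1)).1 := (hcomplete n).resolve_right fun hneg =>
      hcon (.impElim (.hyp (hle (n + 1) hneg)) (.hyp hψ))
    obtain ⟨k, hk⟩ := hwit (G n) (e n) ψ hn hmem
    exact ⟨k, hle (n + 1) hk⟩

end Relational

namespace IsHenkin

theorem mem_of_derivable (h : IsHenkin Γ) {φ : L.Formula ℕ} (hφ : Derivable Γ φ) : φ ∈ Γ :=
  (h.complete φ).resolve_right fun hn => h.consistent (.impElim (.hyp hn) hφ)

theorem imp_mem_iff (h : IsHenkin Γ) {φ ψ : L.Formula ℕ} : φ.imp ψ ∈ Γ ↔ (φ ∈ Γ → ψ ∈ Γ) := by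
  refine ⟨fun himp hφ => h.mem_of_derivable (.impElim (.hyp himp) (.hyp hφ)), fun himp => ?_⟩
  rcases h.complete φ with hφ | hφ
  · exact h.mem_of_derivable (.impIntro (.hyp (.inr (himp hφ))))
  · exact h.mem_of_derivable <| .impIntro <|
      .exfalso (.impElim (.hyp (.inr hφ)) (.hyp (Set.mem_insert _ _)))

theorem all_mem_iff (h : IsHenkin Γ) {ψ : L.BoundedFormula ℕ 1} :
    (ψ.all : L.Formula ℕ) ∈ Γ ↔ ∀ k : ℕ, inst ψ (Term.var k) ∈ Γ := by
  refine ⟨fun hall k => h.mem_of_derivable (.allElim _ (.hyp hall)), fun hinst => ?_⟩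
  refine (h.complete _).resolve_right fun hn => ?_
  obtain ⟨k, hk⟩ := h.witness ψ hn
  exact h.consistent (.impElim (.hyp hk) (.hyp (hinst k)))

theorem equal_self_mem (h : IsHenkin Γ) (i : ℕ) :
    (Term.var i : L.Term ℕ).equal (Term.var i) ∈ Γ :=
  h.mem_of_derivable (.eqRefl _)

theorem inst_mem_of_equal_mem (h : IsHenkin Γ) (φ : L.BoundedFormula ℕ 1) {i j : ℕ}
    (hij : (Term.var i).equal (Term.var j) ∈ Γ) (hi : inst φ (Term.var i) ∈ Γ) :
    inst φ (Term.var j) ∈ Γ :=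
  h.mem_of_derivable (.eqSubst φ (.hyp hij) (.hyp hi))

theorem equal_mem_of_equal_mem (h : IsHenkin Γ) {i j k : ℕ}
    (hij : (Term.var i : L.Term ℕ).equal (Term.var j) ∈ Γ)
    (hik : (Term.var i : L.Term ℕ).equal (Term.var k) ∈ Γ) :
    (Term.var j : L.Term ℕ).equal (Term.var k) ∈ Γ := by
  have hinst := h.inst_mem_of_equal_mem
    (.equal (.var (.inr 0)) (.var (.inl k))) hij
  rw [inst_var_eq_rename, inst_var_eq_rename] at hinst
  exact hinst hik

/-- Equality of variables as decided by a Henkin set. -/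
def setoid (h : IsHenkin Γ) : Setoid ℕ where
  r i j := (Term.var i : L.Term ℕ).equal (Term.var j) ∈ Γ
  iseqv :=
    have symm {i j : ℕ} (hij : (Term.var i : L.Term ℕ).equal (Term.var j) ∈ Γ) :=
      h.equal_mem_of_equal_mem hij (h.equal_self_mem i)
    ⟨h.equal_self_mem, symm, fun hij hjk => h.equal_mem_of_equal_mem (symm hij) hjk⟩

theorem formula_update_mem (h : IsHenkin Γ) {l : ℕ} (R : L.Relations l) {x : Fin l → ℕ} {i : Fin l}
    {k : ℕ} (hk : h.setoid (x i) k) (hx : R.formula (fun j => Term.var (x j)) ∈ Γ) :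
    R.formula (fun j => Term.var (Function.update x i k j)) ∈ Γ := by
  have inst_update : ∀ k, inst (.rel R fun j =>
      .var (Function.update (fun j => Sum.inl (x j)) i (Sum.inr 0) j)) (Term.var k)
      = R.formula fun j => Term.var (Function.update x i k j) := by
    intro k
    rw [inst_var_eq_rename]
    refine congrArg (BoundedFormula.rel R) (funext fun j => ?_)
    rcases eq_or_ne j i with rfl | hj
    · simp [Term.relabel]
    · simp [Term.relabel, hj]
  rw [← inst_update]
  refine h.inst_mem_of_equal_mem _ hk ?_
  rwa [inst_update, Function.update_eq_self]

theorem formula_mem_of_setoid (h : IsHenkin Γ) {l : ℕ} (R : L.Relations l) {x y : Fin l → ℕ}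
    (hxy : ∀ i, h.setoid (x i) (y i)) (hx : R.formula (fun i => Term.var (x i)) ∈ Γ) :
    R.formula (fun i => Term.var (y i)) ∈ Γ := by
  have piecewise_mem : ∀ s : Finset (Fin l),
      R.formula (fun i => Term.var (s.piecewise y x i)) ∈ Γ := by
    intro s
    induction s using Finset.induction_on with
    | empty => rwa [Finset.piecewise_empty]
    | insert i s hi ih =>
      rw [Finset.piecewise_insert]
      refine h.formula_update_mem R ?_ ih
      rw [Finset.piecewise_eq_of_notMem _ _ _ hi]
      exact hxy i
  simpa only [Finset.piecewise_univ] using piecewise_mem Finset.univ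

variable [L.IsRelational]

/-- The term model of a Henkin set: its elements are the variables up to equality. -/
@[reducible] def termModel (h : IsHenkin Γ) : L.Structure (Quotient h.setoid) where
  funMap F := isEmptyElim F
  RelMap R xs := R.formula (fun i => Term.var (xs i).out) ∈ Γ

theorem relMap_mk (h : IsHenkin Γ) {l : ℕ} (R : L.Relations l) (x : Fin l → ℕ) :
    let _ := h.termModel
    Structure.RelMap R (fun i => Quotient.mk h.setoid (x i)) ↔
      R.formula (fun i => Term.var (x i)) ∈ Γ := by
  have hout : ∀ i, h.setoid (Quotient.mk h.setoid (x i)).out (x i) := fun i =>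
    Quotient.mk_out (s := h.setoid) _
  exact ⟨h.formula_mem_of_setoid R hout, h.formula_mem_of_setoid R fun i => h.setoid.symm (hout i)⟩

theorem rename_mem_iff_realize (h : IsHenkin Γ) {α : Type*} {n : ℕ} (φ : L.BoundedFormula α n)
    (ρ : α ⊕ Fin n → ℕ) :
    let _ := h.termModel
    (rename φ (Sum.inl ∘ ρ) : L.Formula ℕ) ∈ Γ ↔
      φ.Realize (fun a => Quotient.mk h.setoid (ρ (Sum.inl a)))
        (fun i => Quotient.mk h.setoid (ρ (Sum.inr i))) := by
  let _ := h.termModel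
  have realize_var : ∀ {n : ℕ} (ρ : α ⊕ Fin n → ℕ) (x : α ⊕ Fin n),
      (Term.var x : L.Term (α ⊕ Fin n)).realize (Sum.elim
        (fun a => Quotient.mk h.setoid (ρ (Sum.inl a)))
        (fun i => Quotient.mk h.setoid (ρ (Sum.inr i)))) = Quotient.mk h.setoid (ρ x) := by
    rintro n ρ (a | i) <;> rfl
  induction φ with
  | falsum => exact ⟨fun hm => h.consistent (.hyp hm), False.elim⟩
  | equal s t =>
    obtain ⟨x, rfl⟩ := exists_eq_var s
    obtain ⟨y, rfl⟩ := exists_eq_var t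
    simp only [BoundedFormula.Realize, realize_var]
    exact (Quotient.eq (r := h.setoid) (x := ρ x) (y := ρ y)).symm
  | rel R ts =>
    choose x hx using fun i => exists_eq_var (ts i)
    obtain rfl : ts = fun i => .var (x i) := funext hx
    simp only [BoundedFormula.Realize, realize_var]
    exact (h.relMap_mk R fun i => ρ (x i)).symm
  | imp φ ψ ihφ ihψ => exact h.imp_mem_iff.trans (imp_congr (ihφ ρ) (ihψ ρ))
  | @all n φ ih =>
    refine h.all_mem_iff.trans ?_
    rw [BoundedFormula.realize_all, (Quotient.mk_surjective (s := h.setoid)).forall]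
    refine forall_congr' fun k => ?_
    let ρk : α ⊕ Fin (n + 1) → ℕ :=
      Sum.elim (ρ ∘ Sum.inl) (Fin.lastCases k fun j => ρ (Sum.inr j))
    have hsnoc : (Fin.snoc (fun i => Quotient.mk h.setoid (ρ (Sum.inr i)))
        (Quotient.mk h.setoid k) : Fin (n + 1) → Quotient h.setoid)
        = fun i => Quotient.mk h.setoid (ρk (Sum.inr i)) := by
      funext i
      refine Fin.lastCases ?_ (fun j => ?_) i <;> simp [ρk]
    rw [inst_rename_liftRen, hsnoc]
    exact ih ρk

theorem models (h : IsHenkin Γ) {T : L.Theory}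
    (hT : (Formula.relabel Empty.elim : L.Sentence → L.Formula ℕ) '' T ⊆ Γ) :
    let _ := h.termModel
    Quotient h.setoid ⊨ T := by
  let _ := h.termModel
  refine ⟨fun σ hσ => ?_⟩
  have hmem : rename σ (Sum.inl ∘ (isEmptyElim : Empty ⊕ Fin 0 → ℕ)) ∈ Γ := by
    have hrelabel := hT (Set.mem_image_of_mem _ hσ)
    rw [relabel_eq_rename] at hrelabel
    rwa [Subsingleton.elim (Sum.inl ∘ isEmptyElim) (Sum.map Empty.elim id)]
  have hreal := (h.rename_mem_iff_realize σ isEmptyElim).1 hmem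
  rw [Sentence.Realize, Formula.Realize]
  convert hreal using 1

end IsHenkin

theorem exists_model_of_consistent [L.IsRelational] [Countable L.Symbols] {T : L.Theory}
    (h : Consistent T) : ∃ (M : Type) (_ : L.Structure M), Nonempty M ∧ M ⊨ T := by
  have hstage : IsStage ((Formula.relabel Empty.elim : L.Sentence → L.Formula ℕ) '' T) :=
    ⟨h, .of_forall fun k => Set.forall_mem_image.2 fun σ _ => isFresh_sentence k σ⟩
  obtain ⟨Δ, hTΔ, hΔ⟩ := hstage.exists_isHenkin
  exact ⟨Quotient hΔ.setoid, hΔ.termModel, ⟨Quotient.mk _ 0⟩, hΔ.models hTΔ⟩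

end Completeness

/-! ## Soundness -/

section Soundness

universe u v w
variable {L : FirstOrder.Language.{u, v}} {M : Type w} [L.Structure M]

theorem realize_inst (φ : L.BoundedFormula ℕ 1) (t : L.Term ℕ) (v : ℕ → M) :
    (inst φ t).Realize v ↔ φ.Realize v (Fin.snoc default (t.realize v)) := by
  rw [inst, Formula.Realize, BoundedFormula.realize_subst]
  refine (BoundedFormula.realize_toFormula φ _).trans (iff_of_eq (congrArg _ (funext fun i => ?_)))
  rw [Subsingleton.elim i (Fin.last 0), Fin.snoc_last]
  rfl

theorem realize_instFresh (φ : L.BoundedFormula ℕ 1) (v : ℕ → M) :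
    (instFresh φ).Realize v ↔ φ.Realize (v ∘ Nat.succ) (Fin.snoc default (v 0)) := by
  rw [instFresh, Formula.realize_relabel]
  refine (BoundedFormula.realize_toFormula φ _).trans (iff_of_eq (congrArg _ (funext fun i => ?_)))
  rw [Subsingleton.elim i (Fin.last 0), Fin.snoc_last]
  rfl

theorem Derivable.sound {Γ : Set (L.Formula ℕ)} {φ : L.Formula ℕ} (h : Derivable Γ φ) (v : ℕ → M)
    (hv : ∀ ψ ∈ Γ, Formula.Realize ψ v) : φ.Realize v := by
  induction h generalizing v with
  | hyp h => exact hv _ h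
  | impIntro _ ih => exact fun hφ => ih v (Set.forall_mem_insert.2 ⟨hφ, hv⟩)
  | impElim _ _ ih₁ ih₂ => exact ih₁ v hv (ih₂ v hv)
  | byContra _ ih => exact not_not.1 fun hn => ih v (Set.forall_mem_insert.2 ⟨hn, hv⟩)
  | allIntro _ ih =>
    intro x
    let w : ℕ → M := fun n => n.casesOn x v
    refine (realize_instFresh _ w).1 (ih w ?_)
    rintro _ ⟨ψ, hψ, rfl⟩
    exact Formula.realize_relabel.2 (hv ψ hψ)
  | allElim t _ ih => exact (realize_inst _ _ _).2 (ih v hv (t.realize v))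
  | eqRefl t => exact Formula.realize_equal.2 rfl
  | eqSubst φ _ _ ih₁ ih₂ =>
    have heq := Formula.realize_equal.1 (ih₁ v hv)
    have hinst := ih₂ v hv
    rw [realize_inst] at hinst ⊢
    rwa [← heq]

theorem consistent_of_model {T : L.Theory} [Nonempty M] (h : M ⊨ T) : Consistent T := by
  intro hbot
  refine hbot.sound (fun _ => Classical.arbitrary M) ?_
  rintro _ ⟨σ, hσ, rfl⟩
  rw [Formula.realize_relabel, Subsingleton.elim (_ ∘ _) default]
  exact h.realize_of_mem σ hσ

end Soundness

/-! ## Definability with parameters -/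

section Definability

open Set

universe u v w
variable {L : FirstOrder.Language.{u, v}} {M : Type w} [L.Structure M] {β γ : Type}

variable (L) in
/-- `P` is definable in the structure `M` by an `L`-formula with parameters from `M`. -/
def DefinablePred (P : (β → M) → Prop) : Prop := (univ : Set M).Definable L {w | P w}

variable (L) in
/-- The unary relation `R` is definable with parameters. -/
abbrev DefinablePred₁ (R : M → Prop) : Prop := DefinablePred L fun w : Fin 1 → M => R (w 0)

variable (L) in
/-- The binary relation `R` is definable with parameters. -/
abbrev DefinablePred₂ (R : M → M → Prop) : Prop :=
  DefinablePred L fun w : Fin 2 → M => R (w 0) (w 1)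

variable (L) in
/-- The ternary relation `R` is definable with parameters. -/
abbrev DefinablePred₃ (R : M → M → M → Prop) : Prop :=
  DefinablePred L fun w : Fin 3 → M => R (w 0) (w 1) (w 2)

@[fun_prop]
theorem definableFun_const (a : M) : (univ : Set M).DefinableFun L fun _ : β → M => a :=
  L.definableFun_const β (mem_univ a)

theorem definableFun_of_isEmpty [IsEmpty β] (f : (β → M) → M) : univ.DefinableFun L f := by
  rw [show f = fun _ => f isEmptyElim from funext fun w => congrArg f (Subsingleton.elim _ _)]
  exact definableFun_const (f isEmptyElim)

namespace DefinablePred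

variable {P Q : (β → M) → Prop}

theorem const (p : Prop) : DefinablePred L fun _ : β → M => p := by
  by_cases hp : p
  · simpa only [DefinablePred, hp] using! definable_univ
  · simpa only [DefinablePred, hp] using! definable_empty

theorem not (hP : DefinablePred L P) : DefinablePred L fun w => ¬ P w := hP.compl

theorem and (hP : DefinablePred L P) (hQ : DefinablePred L Q) :
    DefinablePred L fun w => P w ∧ Q w := hP.inter hQ

theorem or (hP : DefinablePred L P) (hQ : DefinablePred L Q) :
    DefinablePred L fun w => P w ∨ Q w := hP.union hQ

theorem congr (hP : DefinablePred L P) (h : ∀ w, Q w ↔ P w) : DefinablePred L Q := by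
  rwa [show Q = P from funext fun w => propext (h w)]

theorem imp (hP : DefinablePred L P) (hQ : DefinablePred L Q) :
    DefinablePred L fun w => P w → Q w :=
  (hP.not.or hQ).congr fun _ => imp_iff_not_or

theorem iff (hP : DefinablePred L P) (hQ : DefinablePred L Q) :
    DefinablePred L fun w => P w ↔ Q w :=
  ((hP.imp hQ).and (hQ.imp hP)).congr fun _ => iff_iff_implies_and_implies

theorem eq {f g : (β → M) → M} (hf : univ.DefinableFun L f := by fun_prop)
    (hg : univ.DefinableFun L g := by fun_prop) : DefinablePred L fun w => f w = g w :=
  hf.ofPred_eq hg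

theorem comp [Finite γ] {P : (γ → M) → Prop} (hP : DefinablePred L P) {F : (β → M) → γ → M}
    (hF : ∀ c, univ.DefinableFun L fun w => F w c) : DefinablePred L fun w => P (F w) :=
  hP.preimage_map hF

theorem ex {R : (β → M) → M → Prop}
    (hR : DefinablePred L fun w : Option β → M => R (fun i => w (some i)) (w none)) :
    DefinablePred L fun w => ∃ x, R w x := by
  let index : Option β → β ⊕ Unit := fun o => o.elim (Sum.inr ()) Sum.inl
  refine DefinablePred.congr (hR.preimage_comp index).exists_of_finite fun w => ?_
  exact ⟨fun ⟨x, hx⟩ => ⟨fun _ => x, hx⟩, fun ⟨u, hu⟩ => ⟨u (), hu⟩⟩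

theorem all {R : (β → M) → M → Prop}
    (hR : DefinablePred L fun w : Option β → M => R (fun i => w (some i)) (w none)) :
    DefinablePred L fun w => ∀ x, R w x :=
  hR.not.ex.not.congr fun _ => not_exists_not.symm

theorem app₁ {R : M → Prop} (hR : DefinablePred₁ L R) {f : (β → M) → M}
    (hf : univ.DefinableFun L f := by fun_prop) : DefinablePred L fun w => R (f w) :=
  hR.comp (F := fun w => ![f w]) (Fin.forall_fin_one.2 hf)

theorem app₂ {R : M → M → Prop} (hR : DefinablePred₂ L R) {f g : (β → M) → M}
    (hf : univ.DefinableFun L f := by fun_prop) (hg : univ.DefinableFun L g := by fun_prop) :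
    DefinablePred L fun w => R (f w) (g w) :=
  hR.comp (F := fun w => ![f w, g w]) (Fin.forall_fin_two.2 ⟨hf, hg⟩)

theorem app₃ {R : M → M → M → Prop} (hR : DefinablePred₃ L R) {f g h : (β → M) → M}
    (hf : univ.DefinableFun L f := by fun_prop) (hg : univ.DefinableFun L g := by fun_prop)
    (hh : univ.DefinableFun L h := by fun_prop) : DefinablePred L fun w => R (f w) (g w) (h w) :=
  hR.comp (F := fun w => ![f w, g w, h w]) <|
    Fin.forall_fin_succ.2 ⟨hf, Fin.forall_fin_two.2 ⟨hg, hh⟩⟩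

theorem exists_params [Nonempty M] {P : (β → M) → Prop} (hP : DefinablePred L P) :
    ∃ (m : ℕ) (φ : L.Formula (Fin m ⊕ β)) (p : Fin m → M), ∀ w,
      φ.Realize (Sum.elim p w) ↔ P w := by
  classical
  obtain ⟨φ, hφ⟩ := definable_iff_exists_formula_sum.1 hP
  let e := φ.freeVarFinset.equivFin
  let p i : M := Sum.elim Subtype.val (fun _ => Classical.arbitrary M) (e.symm i).1
  refine ⟨_, φ.restrictFreeVar fun x => Sum.elim (fun _ => .inl (e x)) .inr x.1, p, fun w => ?_⟩
  refine Iff.trans ?_ (Set.ext_iff.1 hφ w).symm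
  refine BoundedFormula.realize_restrictFreeVar (Sum.elim Subtype.val w) ?_
  rintro ⟨x | x, hx⟩ <;> simp [p]

end DefinablePred

section Interpretation

variable {L' : FirstOrder.Language.{u, v}} [L'.Structure M]

theorem definableFun_realize
    (hfun : ∀ {n} (f : L'.Functions n), (univ : Set M).DefinableFun L (Structure.funMap f)) :
    ∀ t : L'.Term β, (univ : Set M).DefinableFun L fun w => t.realize w
  | .var i => by
    simp only [Term.realize_var]
    fun_prop
  | .func f ts => (hfun f).comp fun i => definableFun_realize hfun (ts i)

theorem definablePred_boundedFormula_realize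
    (hfun : ∀ {n} (f : L'.Functions n), (univ : Set M).DefinableFun L (Structure.funMap f))
    (hrel : ∀ {n} (R : L'.Relations n),
      DefinablePred L fun xs : Fin n → M => Structure.RelMap R xs)
    {n : ℕ} (φ : L'.BoundedFormula β n) :
    DefinablePred L fun w : β ⊕ Fin n → M => φ.Realize (w ∘ Sum.inl) (w ∘ Sum.inr) := by
  induction φ with
  | falsum => exact .const False
  | equal s t =>
    refine DefinablePred.congr (.eq (definableFun_realize hfun s) (definableFun_realize hfun t))
      fun w => ?_
    rw [BoundedFormula.Realize, Sum.elim_comp_inl_inr]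
  | rel R ts =>
    refine ((hrel R).comp fun i => definableFun_realize hfun (ts i)).congr fun w => ?_
    rw [BoundedFormula.Realize, Sum.elim_comp_inl_inr]
  | imp _ _ ihφ ihψ => exact ihφ.imp ihψ
  | @all n φ ih =>
    let index : β ⊕ Fin (n + 1) → Option (β ⊕ Fin n) :=
      Sum.elim (fun b => some (.inl b)) (Fin.lastCases none fun i => some (.inr i))
    refine DefinablePred.all (DefinablePred.congr (ih.preimage_comp index) fun w => ?_)
    refine iff_of_eq (congrArg (φ.Realize _) (funext fun i => ?_))
    cases i using Fin.lastCases <;> simp [index]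

theorem definablePred_realize
    (hfun : ∀ {n} (f : L'.Functions n), (univ : Set M).DefinableFun L (Structure.funMap f))
    (hrel : ∀ {n} (R : L'.Relations n),
      DefinablePred L fun xs : Fin n → M => Structure.RelMap R xs)
    (φ : L'.Formula β) : DefinablePred L fun w : β → M => φ.Realize w := by
  let index : β ⊕ Fin 0 → β := Sum.elim id Fin.elim0
  refine DefinablePred.congr
    ((definablePred_boundedFormula_realize hfun hrel φ).preimage_comp index) fun w => ?_
  exact iff_of_eq (congrArg (BoundedFormula.Realize φ w) (Subsingleton.elim _ _))

end Interpretation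

end Definability

/-! ## Universes of sets -/

section SetUniverse

universe u v w
variable {L : FirstOrder.Language.{u, v}} {M : Type w} [L.Structure M] {E : M → M → Prop}
  {S : M → Prop}

variable (L) in
/-- The set-theoretical axioms other than infinity for a membership relation `E` and a sort of sets
`S`, both definable in the structure `M`. Things that are not sets have no elements. Separation and
replacement are asserted for everything that is definable in `M`. -/
structure SetUniverse (E : M → M → Prop) (S : M → Prop) : Prop where
  definable_mem : DefinablePred₂ L E
  definable_isSet : DefinablePred₁ L S
  isSet_of_mem : ∀ {x y}, E x y → S y
  ext : ∀ {x y}, S x → S y → (∀ z, E z x ↔ E z y) → x = y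
  empty : ∃ x, S x ∧ ∀ y, ¬ E y x
  pair : ∀ x y, ∃ z, S z ∧ ∀ w, E w z ↔ w = x ∨ w = y
  union : ∀ x, ∃ y, S y ∧ ∀ z, E z y ↔ ∃ w, E w x ∧ E z w
  power : ∀ x, ∃ y, S y ∧ ∀ z, E z y ↔ S z ∧ ∀ w, E w z → E w x
  regularity : ∀ x, (∃ y, E y x) → ∃ y, E y x ∧ ∀ z, E z y → ¬ E z x
  separation : ∀ {P : M → Prop}, DefinablePred₁ L P → ∀ x, ∃ y, S y ∧ ∀ z, E z y ↔ E z x ∧ P z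
  replacement : ∀ {R : M → M → Prop}, DefinablePred₂ L R → ∀ x,
    (∀ y, E y x → ∃! z, R y z) → ∃ z, S z ∧ ∀ w, E w z ↔ ∃ y, E y x ∧ R y w

namespace SetUniverse

theorem exists_insert (U : SetUniverse L E S) (x a : M) :
    ∃ y, S y ∧ ∀ z, E z y ↔ E z x ∨ z = a := by
  obtain ⟨s, -, hs⟩ := U.pair a a
  obtain ⟨p, -, hp⟩ := U.pair x s
  obtain ⟨u, hSu, hu⟩ := U.union p
  refine ⟨u, hSu, fun z => ?_⟩
  simp only [hu, hp, hs, or_and_right, exists_or, exists_eq_left, or_self]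

theorem exists_descending_of_transGen (U : SetUniverse L E S) {a b : M}
    (h : Relation.TransGen E a b) :
    ∃ s, E b s ∧ ∀ y, E y s → ∃ z, E z y ∧ (E z s ∨ z = a) := by
  induction h with
  | @single b hab =>
    obtain ⟨s, -, hs⟩ := U.pair b b
    refine ⟨s, (hs b).2 (.inl rfl), fun y hy => ⟨a, ?_, .inr rfl⟩⟩
    obtain rfl : y = b := by simpa only [or_self] using (hs y).1 hy
    exact hab
  | @tail b c _ hbc ih =>
    obtain ⟨s, hbs, hs⟩ := ih
    obtain ⟨t, -, ht⟩ := U.exists_insert s c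
    refine ⟨t, (ht c).2 (.inr rfl), fun y hy => ?_⟩
    rcases (ht y).1 hy with hys | rfl
    · obtain ⟨z, hzy, hz⟩ := hs y hys
      exact ⟨z, hzy, hz.imp_left fun hzs => (ht z).2 (.inl hzs)⟩
    · exact ⟨b, hbc, .inl ((ht b).2 (.inl hbs))⟩

theorem not_transGen_self (U : SetUniverse L E S) (x : M) : ¬ Relation.TransGen E x x := by
  intro h
  obtain ⟨s, hxs, hs⟩ := U.exists_descending_of_transGen h
  obtain ⟨y, hys, hmin⟩ := U.regularity s ⟨x, hxs⟩
  obtain ⟨z, hzy, hzs | rfl⟩ := hs y hys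
  exacts [hmin z hzy hzs, hmin z hzy hxs]

theorem mem_asymm (U : SetUniverse L E S) {x y : M} (hxy : E x y) : ¬ E y x := fun hyx =>
  U.not_transGen_self x (.tail (.single hxy) hyx)

theorem mem_irrefl (U : SetUniverse L E S) (x : M) : ¬ E x x := fun hx => U.mem_asymm hx hx

end SetUniverse

/-- `p` is the set `{a, b}`. -/
def IsPair (E : M → M → Prop) (S : M → Prop) (p a b : M) : Prop :=
  S p ∧ ∀ z, E z p ↔ z = a ∨ z = b

/-- `s` is the set `{a}`. -/
def IsSingleton (E : M → M → Prop) (S : M → Prop) (s a : M) : Prop :=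
  S s ∧ ∀ z, E z s ↔ z = a

/-- `p` is the two-tuple `(a, b) = {a, {a, b}}`. -/
def IsTuple (E : M → M → Prop) (S : M → Prop) (p a b : M) : Prop :=
  ∃ q, IsPair E S q a b ∧ IsPair E S p a q

/-- The two-tuple `(a, b)` is an element of `f`. -/
def TupleMem (E : M → M → Prop) (S : M → Prop) (a b f : M) : Prop :=
  ∃ p, IsTuple E S p a b ∧ E p f

/-- `k` is the von Neumann successor `n ∪ {n}`. -/
def IsSucc (E : M → M → Prop) (S : M → Prop) (k n : M) : Prop :=
  S k ∧ ∀ z, E z k ↔ E z n ∨ z = n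

theorem IsPair.right_unique {p a b b' : M} (h : IsPair E S p a b) (h' : IsPair E S p a b') :
    b = b' := by
  rcases (h'.2 b).1 ((h.2 b).2 (.inr rfl)) with rfl | rfl
  · rcases (h.2 b').1 ((h'.2 b').2 (.inr rfl)) with rfl | rfl <;> rfl
  · rfl

theorem IsSucc.mem_self {k n : M} (h : IsSucc E S k n) : E n k := (h.2 n).2 (.inr rfl)

namespace SetUniverse

theorem exists_singleton (U : SetUniverse L E S) (a : M) : ∃ s, IsSingleton E S s a := by
  simpa only [IsSingleton, or_self] using U.pair a a

theorem exists_tuple (U : SetUniverse L E S) (a b : M) : ∃ p, IsTuple E S p a b := by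
  obtain ⟨q, hq⟩ := U.pair a b
  obtain ⟨p, hp⟩ := U.pair a q
  exact ⟨p, q, hq, hp⟩

theorem isTuple_inj (U : SetUniverse L E S) {p a b a' b' : M} (h : IsTuple E S p a b)
    (h' : IsTuple E S p a' b') : a = a' ∧ b = b' := by
  obtain ⟨q, hq, -, hp⟩ := h
  obtain ⟨q', hq', -, hp'⟩ := h'
  have haq : E a q := (hq.2 a).2 (.inl rfl)
  have haq' : E a' q' := (hq'.2 a').2 (.inl rfl)
  obtain rfl : a = a' := by
    rcases (hp' a).1 ((hp a).2 (.inl rfl)) with h₁ | rfl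
    · exact h₁
    rcases (hp a').1 ((hp' a').2 (.inl rfl)) with h₂ | rfl
    · exact h₂.symm
    · exact absurd haq (U.mem_asymm haq')
  obtain rfl : q = q' := by
    rcases (hp' q).1 ((hp q).2 (.inr rfl)) with rfl | h₁
    exacts [absurd haq (U.mem_irrefl _), h₁]
  exact ⟨rfl, hq.right_unique hq'⟩

theorem isTuple_unique (U : SetUniverse L E S) {p p' a b : M} (h : IsTuple E S p a b)
    (h' : IsTuple E S p' a b) : p = p' := by
  obtain ⟨q, hq, hp⟩ := h
  obtain ⟨q', hq', hp'⟩ := h'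
  obtain rfl : q = q' := U.ext hq.1 hq'.1 fun z => (hq.2 z).trans (hq'.2 z).symm
  exact U.ext hp.1 hp'.1 fun z => (hp.2 z).trans (hp'.2 z).symm

theorem isSucc_inj (U : SetUniverse L E S) {k m n : M} (hm : IsSucc E S k m)
    (hn : IsSucc E S k n) : m = n := by
  rcases (hn.2 m).1 hm.mem_self with hmn | rfl
  · rcases (hm.2 n).1 hn.mem_self with hnm | rfl
    exacts [absurd hnm (U.mem_asymm hmn), rfl]
  · rfl

theorem definable_isPair (U : SetUniverse L E S) : DefinablePred₃ L (IsPair E S) :=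
  .and U.definable_isSet.app₁ (.all (.iff U.definable_mem.app₂ (.or .eq .eq)))

theorem definable_isSingleton (U : SetUniverse L E S) : DefinablePred₂ L (IsSingleton E S) :=
  .and U.definable_isSet.app₁ (.all (.iff U.definable_mem.app₂ .eq))

theorem definable_isTuple (U : SetUniverse L E S) : DefinablePred₃ L (IsTuple E S) :=
  .ex (.and U.definable_isPair.app₃ U.definable_isPair.app₃)

theorem definable_tupleMem (U : SetUniverse L E S) : DefinablePred₃ L (TupleMem E S) :=
  .ex (.and U.definable_isTuple.app₃ U.definable_mem.app₂)

theorem definable_isSucc (U : SetUniverse L E S) : DefinablePred₂ L (IsSucc E S) :=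
  .and U.definable_isSet.app₁ (.all (.iff U.definable_mem.app₂ (.or U.definable_mem.app₂ .eq)))

end SetUniverse

end SetUniverse

section Iteration

universe u v w
variable {L : FirstOrder.Language.{u, v}} {M : Type w} [L.Structure M] {E : M → M → Prop}
  {S : M → Prop}

/-- The axiom of infinity: there is a set that contains an empty thing and is closed under von
Neumann successors. -/
def HasInductiveSet (E : M → M → Prop) (S : M → Prop) : Prop :=
  ∃ I, (∃ e, (∀ y, ¬ E y e) ∧ E e I) ∧ ∀ n, E n I → ∃ k, E k I ∧ IsSucc E S k n

/-- A set `s` of tuples in which each `(k, y)` is `(0, z)` or arises from some `(n, x)` in `s` as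
`(n + 1, σ x)`, so that `y` is an iterate of `σ` at `z`. -/
def IsIteration (E : M → M → Prop) (S : M → Prop) (z : M) (σ : M → M) (s : M) : Prop :=
  ∀ k y, TupleMem E S k y s → ((∀ i, ¬ E i k) ∧ y = z) ∨
    ∃ n x, TupleMem E S n x s ∧ IsSucc E S k n ∧ y = σ x

/-- `x` is the `n`-th iterate of `σ` at `z`. -/
def IsIterate (E : M → M → Prop) (S : M → Prop) (z : M) (σ : M → M) (n x : M) : Prop :=
  ∃ s, TupleMem E S n x s ∧ IsIteration E S z σ s

theorem IsIterate.eq_of_empty {z : M} {σ : M → M} {e x : M} (hx : IsIterate E S z σ e x)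
    (he : ∀ i, ¬ E i e) : x = z := by
  obtain ⟨s, hs, hiter⟩ := hx
  rcases hiter _ _ hs with ⟨-, hxz⟩ | ⟨n, -, -, hn, -⟩
  exacts [hxz, absurd hn.mem_self (he n)]

namespace SetUniverse

theorem definable_isIterate (U : SetUniverse L E S) (z : M) {σ : M → M}
    (hσ : DefinablePred₂ L fun x y => y = σ x) : DefinablePred₂ L (IsIterate E S z σ) :=
  .ex (.and U.definable_tupleMem.app₃ (.all (.all (.imp U.definable_tupleMem.app₃ (.or
    (.and (.all U.definable_mem.app₂.not) .eq)
    (.ex (.ex (.and U.definable_tupleMem.app₃ (.and U.definable_isSucc.app₂ hσ.app₂)))))))))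

theorem isIterate_of_empty (U : SetUniverse L E S) (z : M) (σ : M → M) {e : M}
    (he : ∀ i, ¬ E i e) : IsIterate E S z σ e z := by
  obtain ⟨p, hp⟩ := U.exists_tuple e z
  obtain ⟨s, -, hs⟩ := U.exists_singleton p
  refine ⟨s, ⟨p, hp, (hs p).2 rfl⟩, fun k y ⟨q, hq, hqs⟩ => ?_⟩
  obtain rfl := (hs q).1 hqs
  obtain ⟨rfl, rfl⟩ := U.isTuple_inj hp hq
  exact .inl ⟨he, rfl⟩

theorem isIterate_of_isSucc (U : SetUniverse L E S) {z : M} {σ : M → M} {k n x : M}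
    (hk : IsSucc E S k n) (hx : IsIterate E S z σ n x) : IsIterate E S z σ k (σ x) := by
  obtain ⟨s, hnx, hiter⟩ := hx
  obtain ⟨p, hp⟩ := U.exists_tuple k (σ x)
  obtain ⟨t, -, ht⟩ := U.exists_insert s p
  have hst : ∀ a b, TupleMem E S a b s → TupleMem E S a b t :=
    fun a b ⟨q, hq, hqs⟩ => ⟨q, hq, (ht q).2 (.inl hqs)⟩
  refine ⟨t, ⟨p, hp, (ht p).2 (.inr rfl)⟩, fun k' y ⟨q, hq, hqt⟩ => ?_⟩
  rcases (ht q).1 hqt with hqs | rfl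
  · exact (hiter k' y ⟨q, hq, hqs⟩).imp_right fun ⟨n, x, hn, hr⟩ => ⟨n, x, hst _ _ hn, hr⟩
  · obtain ⟨rfl, rfl⟩ := U.isTuple_inj hp hq
    exact .inr ⟨n, x, hst _ _ hnx, hk, rfl⟩

theorem exists_of_isIterate_of_isSucc (U : SetUniverse L E S) {z : M} {σ : M → M} {k n y : M}
    (hk : IsSucc E S k n) (hy : IsIterate E S z σ k y) : ∃ x, IsIterate E S z σ n x ∧ y = σ x := by
  obtain ⟨s, hs, hiter⟩ := hy
  rcases hiter _ _ hs with ⟨hempty, -⟩ | ⟨m, x, hx, hm, rfl⟩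
  · exact absurd hk.mem_self (hempty n)
  · obtain rfl := U.isSucc_inj hk hm
    exact ⟨x, ⟨s, hx, hiter⟩, rfl⟩

theorem exists_closed (U : SetUniverse L E S) (hinf : HasInductiveSet E S) (z : M) {σ : M → M}
    (hσ : DefinablePred₂ L fun x y => y = σ x) :
    ∃ W, E z W ∧ ∀ x, E x W → E (σ x) W := by
  obtain ⟨I, ⟨e, he, heI⟩, hI⟩ := hinf
  have hiter := U.definable_isIterate z hσ
  -- Restricting to the `n` with a unique iterate replaces the induction along `I`.
  obtain ⟨J, -, hJ⟩ := U.separation (P := fun n => ∃! x, IsIterate E S z σ n x)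
    (.ex (.and hiter.app₂ (.all (.imp hiter.app₂ .eq)))) I
  obtain ⟨W, -, hW⟩ := U.replacement hiter J fun n hn => ((hJ n).1 hn).2
  refine ⟨W, (hW z).2 ⟨e, (hJ e).2 ⟨heI, z, ?_, ?_⟩, U.isIterate_of_empty z σ he⟩, ?_⟩
  · exact U.isIterate_of_empty z σ he
  · exact fun x hx => hx.eq_of_empty he
  intro x hx
  obtain ⟨n, hnJ, hnx⟩ := (hW x).1 hx
  obtain ⟨hnI, hunique⟩ := (hJ n).1 hnJ
  obtain ⟨k, hkI, hk⟩ := hI n hnI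
  refine (hW _).2 ⟨k, (hJ k).2 ⟨hkI, σ x, U.isIterate_of_isSucc hk hnx, fun y hy => ?_⟩,
    U.isIterate_of_isSucc hk hnx⟩
  obtain ⟨x', hx', rfl⟩ := U.exists_of_isIterate_of_isSucc hk hy
  rw [hunique.unique hx' hnx]

theorem exists_orbit (U : SetUniverse L E S) (hinf : HasInductiveSet E S) (z : M) {σ : M → M}
    (hσ : DefinablePred₂ L fun x y => y = σ x) :
    ∃ W, E z W ∧ (∀ x, E x W → E (σ x) W) ∧ ∀ x, E x W → x = z ∨ ∃ y, E y W ∧ x = σ y := by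
  obtain ⟨V, hzV, hV⟩ := U.exists_closed hinf z hσ
  have hclosed : DefinablePred₁ L fun J => E z J ∧ ∀ x, E x J → ∀ y, y = σ x → E y J :=
    .and U.definable_mem.app₂ (.all (.imp U.definable_mem.app₂
      (.all (.imp hσ.app₂ U.definable_mem.app₂))))
  obtain ⟨W, -, hW⟩ := U.separation
    (P := fun x => ∀ J, (E z J ∧ ∀ x, E x J → ∀ y, y = σ x → E y J) → E x J)
    (.all (.imp hclosed.app₁ U.definable_mem.app₂)) V
  have hzW : E z W := (hW z).2 ⟨hzV, fun J hJ => hJ.1⟩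
  have hσW : ∀ x, E x W → E (σ x) W := fun x hx =>
    (hW _).2 ⟨hV x ((hW x).1 hx).1, fun J hJ => hJ.2 x (((hW x).1 hx).2 J hJ) _ rfl⟩
  obtain ⟨J, -, hJ⟩ := U.separation (P := fun x => x = z ∨ ∃ y, E y W ∧ x = σ y)
    (.or .eq (.ex (.and U.definable_mem.app₂ hσ.app₂))) W
  refine ⟨W, hzW, hσW, fun x hx => ((hJ x).1 (((hW x).1 hx).2 J ⟨(hJ z).2 ⟨hzW, .inl rfl⟩, ?_⟩)).2⟩
  rintro y hy _ rfl
  have hyW : E y W := ((hJ y).1 hy).1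
  exact (hJ _).2 ⟨hσW y hyW, .inr ⟨y, hyW, rfl⟩⟩

end SetUniverse

end Iteration

section Schemata

universe u v w
variable {L : FirstOrder.Language.{u, v}} {M : Type w} [L.Structure M] {m d : ℕ}

theorem realize_closure {φ : L.Formula (Fin m)} : M ⊨ closure φ ↔ ∀ p : Fin m → M, φ.Realize p :=
  BoundedFormula.realize_alls.trans (forall_congr' fun _ => Formula.realize_relabel_sumInr φ)

variable {p : Fin m → M} {xs : Fin d → M}

theorem realize_at' {j : ℕ} {φ : L.Formula (Fin m ⊕ Fin j)} {w : Fin j → Fin d} :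
    (at' φ w).Realize p xs ↔ φ.Realize (Sum.elim p (xs ∘ w)) := by
  refine BoundedFormula.realize_relabel.trans (iff_of_eq ?_)
  rw [Formula.Realize]
  congr 1
  · exact funext fun x => by rcases x with x | x <;> rfl
  · exact Subsingleton.elim _ _

theorem realize_at'_one {φ : L.Formula (Fin m ⊕ Fin 1)} {a : Fin d} :
    (at' φ ![a]).Realize p xs ↔ φ.Realize (Sum.elim p ![xs a]) := by
  rw [realize_at']
  exact iff_of_eq (congrArg (fun w => φ.Realize (Sum.elim p w)) (FinVec.map_eq xs _).symm)

theorem realize_at'_two {φ : L.Formula (Fin m ⊕ Fin 2)} {a b : Fin d} :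
    (at' φ ![a, b]).Realize p xs ↔ φ.Realize (Sum.elim p ![xs a, xs b]) := by
  rw [realize_at']
  exact iff_of_eq (congrArg (fun w => φ.Realize (Sum.elim p w)) (FinVec.map_eq xs _).symm)

end Schemata

section ZFModels

universe w
variable {M : Type w} [LZF.Structure M]

/-- Membership in a model of ZF. -/
def Mem (a b : M) : Prop := Structure.RelMap (L := LZF) ZFRel.mem ![a, b]

theorem realize_zmem {α : Type} {n : ℕ} {a b : LZF.Term (α ⊕ Fin n)} {v : α → M}
    {xs : Fin n → M} : (zmem a b).Realize v xs ↔
      Mem (a.realize (Sum.elim v xs)) (b.realize (Sum.elim v xs)) :=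
  BoundedFormula.realize_rel₂ (L := LZF) (R := ZFRel.mem)

theorem definable_mem : DefinablePred₂ LZF (Mem (M := M)) := by
  refine (Set.empty_definable_iff.2 ⟨zmem (.var (.inl 0)) (.var (.inl 1)), ?_⟩).mono
    (Set.empty_subset _)
  exact Set.ext fun w => (realize_zmem (a := .var (.inl 0)) (b := .var (.inl 1))).symm

theorem exists_separation_of_models [Nonempty M] (h : M ⊨ ZF) {P : M → Prop}
    (hP : DefinablePred₁ LZF P) (x : M) : ∃ y, ∀ z, Mem z y ↔ Mem z x ∧ P z := by
  obtain ⟨m, φ, p, hφ⟩ := hP.exists_params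
  have hax := realize_closure.1 (h.realize_of_mem (zfSeparation φ) (.inl (.inr ⟨m, φ, rfl⟩))) p
  rw [Formula.Realize] at hax
  revert x
  simpa [realize_zmem, Fin.snoc, realize_at'_one, hφ] using hax

theorem exists_replacement_of_models [Nonempty M] (h : M ⊨ ZF) {R : M → M → Prop}
    (hR : DefinablePred₂ LZF R) (x : M) (hx : ∀ y, Mem y x → ∃! z, R y z) :
    ∃ z, ∀ w, Mem w z ↔ ∃ y, Mem y x ∧ R y w := by
  obtain ⟨m, φ, p, hφ⟩ := hR.exists_params
  have hax := realize_closure.1 (h.realize_of_mem (zfReplacement φ) (.inr ⟨m, φ, rfl⟩)) p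
  rw [Formula.Realize] at hax
  revert x
  simpa [realize_zmem, Fin.snoc, realize_at'_two, hφ, ExistsUnique] using hax

theorem hasInductiveSet_of_models (h : M ⊨ ZF) : HasInductiveSet Mem fun _ : M => True := by
  simpa [HasInductiveSet, IsSucc, zfInfinity, Sentence.Realize, Formula.Realize, realize_zmem,
    Fin.snoc] using h.realize_of_mem zfInfinity (.inl (.inl (by simp)))

theorem setUniverse_of_models [Nonempty M] (h : M ⊨ ZF) :
    SetUniverse LZF Mem fun _ : M => True where
  definable_mem := definable_mem
  definable_isSet := .const True
  isSet_of_mem _ := trivial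
  ext {x y} _ _ := by
    suffices ∀ x y : M, (∀ z, Mem z x ↔ Mem z y) → x = y from this x y
    simpa [zfExtensionality, Sentence.Realize, Formula.Realize, realize_zmem, Fin.snoc]
      using h.realize_of_mem zfExtensionality (.inl (.inl (by simp)))
  empty := by
    simpa [zfEmpty, Sentence.Realize, Formula.Realize, realize_zmem, Fin.snoc]
      using h.realize_of_mem zfEmpty (.inl (.inl (by simp)))
  pair := by
    simpa [zfPairing, Sentence.Realize, Formula.Realize, realize_zmem, Fin.snoc]
      using h.realize_of_mem zfPairing (.inl (.inl (by simp)))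
  union := by
    simpa [zfUnion, Sentence.Realize, Formula.Realize, realize_zmem, Fin.snoc]
      using h.realize_of_mem zfUnion (.inl (.inl (by simp)))
  power := by
    simpa [zfPower, Sentence.Realize, Formula.Realize, realize_zmem, Fin.snoc]
      using h.realize_of_mem zfPower (.inl (.inl (by simp)))
  regularity := by
    simpa [zfRegularity, Sentence.Realize, Formula.Realize, realize_zmem, Fin.snoc]
      using h.realize_of_mem zfRegularity (.inl (.inl (by simp)))
  separation hP x := by
    simpa only [true_and] using exists_separation_of_models h hP x
  replacement hR x hx := by
    simpa only [true_and] using exists_replacement_of_models h hR x hx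

end ZFModels

/-! ## Coding functions as things that are not sets -/

section CodedUniverse

universe u v w
variable {L : FirstOrder.Language.{u, v}} {M : Type w} [L.Structure M] {E : M → M → Prop}
  {S : M → Prop}

variable (L) in
/-- A universe of sets together with a relation `C f F`, to be read as: the thing `f`, which is not
a set, is a code for the set `F`. Functions will be the codes of their graphs. The set `W` is the
`ω` of the theory of sets and functions, in which the successor of `n` is `{n}`. -/
structure CodedUniverse (E : M → M → Prop) (S : M → Prop) (C : M → M → Prop) : Prop
    extends SetUniverse L E S where
  definable_code : DefinablePred₂ L C
  exists_omega : ∃ W, S W ∧ (∃ e, S e ∧ (∀ y, ¬ E y e) ∧ E e W) ∧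
    (∀ n, E n W → ∃ k, IsSingleton E S k n ∧ E k W) ∧
    ∀ k, E k W → (S k ∧ ∀ y, ¬ E y k) ∨ ∃ n, IsSingleton E S k n ∧ E n W
  not_isSet_of_code : ∀ {f F}, C f F → ¬ S f
  code_unique : ∀ {f F G}, C f F → C f G → F = G
  exists_code : ∀ {F}, S F → ∃ f, C f F
  not_transGen_of_code : ∀ {f F}, C f F → ¬ Relation.TransGen E f F

/-- `s` is the von Neumann successor `x ∪ {x}` of a set, and as such represents `x`. -/
def IsSuccSet (E : M → M → Prop) (S : M → Prop) (s : M) : Prop := ∃ x, S x ∧ IsSucc E S s x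

/-- `y` is an element of the set that `s` represents. -/
def SuccMem (E : M → M → Prop) (S : M → Prop) (y s : M) : Prop := ∃ x, IsSucc E S s x ∧ E y x

/-- `f` is the singleton `{F}` of the representative `F` of a set. -/
def IsSingletonCode (E : M → M → Prop) (S : M → Prop) (f F : M) : Prop :=
  IsSuccSet E S F ∧ IsSingleton E S f F

theorem SuccMem.mem {y s : M} : SuccMem E S y s → E y s := fun ⟨_, hs, hy⟩ => (hs.2 y).2 (.inl hy)

namespace SetUniverse

theorem definable_isSuccSet (U : SetUniverse L E S) : DefinablePred₁ L (IsSuccSet E S) :=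
  .ex (.and U.definable_isSet.app₁ U.definable_isSucc.app₂)

theorem definable_succMem (U : SetUniverse L E S) : DefinablePred₂ L (SuccMem E S) :=
  .ex (.and U.definable_isSucc.app₂ U.definable_mem.app₂)

theorem succMem_iff (U : SetUniverse L E S) {s x y : M} (hs : IsSucc E S s x) :
    SuccMem E S y s ↔ E y x := by
  refine ⟨fun ⟨x', hs', hy⟩ => ?_, fun hy => ⟨x, hs, hy⟩⟩
  rwa [U.isSucc_inj hs hs']

theorem isSucc_unique (U : SetUniverse L E S) {k k' n : M} (hk : IsSucc E S k n)
    (hk' : IsSucc E S k' n) : k = k' :=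
  U.ext hk.1 hk'.1 fun z => (hk.2 z).trans (hk'.2 z).symm

theorem exists_isSucc (U : SetUniverse L E S) (n : M) : ∃ k, IsSucc E S k n := U.exists_insert n n

theorem exists_isSuccSet (U : SetUniverse L E S) {P : M → Prop}
    (hP : ∃ x, S x ∧ ∀ z, E z x ↔ P z) : ∃ s, IsSuccSet E S s ∧ ∀ z, SuccMem E S z s ↔ P z := by
  obtain ⟨x, hSx, hx⟩ := hP
  obtain ⟨s, hs⟩ := U.exists_isSucc x
  exact ⟨s, ⟨x, hSx, hs⟩, fun z => (U.succMem_iff hs).trans (hx z)⟩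

theorem exists_isSuccSet_of_bounded (U : SetUniverse L E S) {P : M → Prop}
    (hP : DefinablePred₁ L P) (b : M) (hb : ∀ z, P z → E z b) :
    ∃ s, IsSuccSet E S s ∧ ∀ z, SuccMem E S z s ↔ P z := by
  obtain ⟨x, hSx, hx⟩ := U.separation hP b
  exact U.exists_isSuccSet ⟨x, hSx, fun z => (hx z).trans (and_iff_right_of_imp (hb z))⟩

theorem exists_set_of_succMem (U : SetUniverse L E S) (s : M) :
    ∃ x, ∀ z, E z x ↔ SuccMem E S z s := by
  obtain ⟨x, -, hx⟩ := U.separation (P := fun z => SuccMem E S z s) U.definable_succMem.app₂ s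
  exact ⟨x, fun z => (hx z).trans (and_iff_right_of_imp SuccMem.mem)⟩

theorem succMem_union (U : SetUniverse L E S) (s : M) :
    ∃ t, IsSuccSet E S t ∧ ∀ z, SuccMem E S z t ↔ ∃ w, SuccMem E S w s ∧ SuccMem E S z w := by
  obtain ⟨b, -, hb⟩ := U.union s
  refine U.exists_isSuccSet_of_bounded
    (.ex (.and U.definable_succMem.app₂ U.definable_succMem.app₂)) b ?_
  exact fun z ⟨w, hw, hz⟩ => (hb z).2 ⟨w, hw.mem, hz.mem⟩

theorem succMem_power (U : SetUniverse L E S) (s : M) :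
    ∃ t, IsSuccSet E S t ∧ ∀ z, SuccMem E S z t ↔
      IsSuccSet E S z ∧ ∀ w, SuccMem E S w z → SuccMem E S w s := by
  obtain ⟨q, -, hq⟩ := U.power s
  obtain ⟨b, -, hb⟩ := U.replacement (R := fun x k => IsSucc E S k x) U.definable_isSucc.app₂ q
    fun x _ => (U.exists_isSucc x).imp fun k hk => ⟨hk, fun k' hk' => U.isSucc_unique hk' hk⟩
  refine U.exists_isSuccSet_of_bounded (.and U.definable_isSuccSet.app₁
    (.all (.imp U.definable_succMem.app₂ U.definable_succMem.app₂))) b ?_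
  rintro z ⟨⟨x, hSx, hx⟩, hz⟩
  exact (hb z).2 ⟨x, (hq x).2 ⟨hSx, fun w hw => (hz w ((U.succMem_iff hx).2 hw)).mem⟩, hx⟩

theorem succUniverse (U : SetUniverse L E S) : SetUniverse L (SuccMem E S) (IsSuccSet E S) where
  definable_mem := U.definable_succMem
  definable_isSet := U.definable_isSuccSet
  isSet_of_mem := fun ⟨x, hs, hy⟩ => ⟨x, U.isSet_of_mem hy, hs⟩
  ext := by
    rintro s t ⟨x, hSx, hs⟩ ⟨y, hSy, ht⟩ h
    obtain rfl : x = y := U.ext hSx hSy fun z => by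
      rw [← U.succMem_iff hs, h, U.succMem_iff ht]
    exact U.isSucc_unique hs ht
  empty := by
    obtain ⟨x, hSx, hx⟩ := U.empty
    simpa only [iff_false] using
      U.exists_isSuccSet (P := fun _ => False) ⟨x, hSx, fun z => iff_false_intro (hx z)⟩
  pair x y := U.exists_isSuccSet (U.pair x y)
  union := U.succMem_union
  power := U.succMem_power
  regularity s := by
    rintro ⟨y, hy⟩
    obtain ⟨x, hx⟩ := U.exists_set_of_succMem s
    obtain ⟨m, hm, hmin⟩ := U.regularity x ⟨y, (hx y).2 hy⟩
    exact ⟨m, (hx m).1 hm, fun z hz hzs => hmin z hz.mem ((hx z).2 hzs)⟩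
  separation hP s := U.exists_isSuccSet_of_bounded (.and U.definable_succMem.app₂ hP.app₁) s
    fun _ hz => hz.1.mem
  replacement hR s hs := by
    obtain ⟨x, hx⟩ := U.exists_set_of_succMem s
    simp only [← hx] at hs ⊢
    exact U.exists_isSuccSet (U.replacement hR x hs)

theorem exists_succOmega (U : SetUniverse L E S) (hinf : HasInductiveSet E S) :
    ∃ W, IsSuccSet E S W ∧
      (∃ e, IsSuccSet E S e ∧ (∀ y, ¬ SuccMem E S y e) ∧ SuccMem E S e W) ∧
      (∀ n, SuccMem E S n W →
        ∃ k, IsSingleton (SuccMem E S) (IsSuccSet E S) k n ∧ SuccMem E S k W) ∧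
      ∀ k, SuccMem E S k W → (IsSuccSet E S k ∧ ∀ y, ¬ SuccMem E S y k) ∨
        ∃ n, IsSingleton (SuccMem E S) (IsSuccSet E S) k n ∧ SuccMem E S n W := by
  have V := U.succUniverse
  obtain ⟨e, heS, he⟩ := V.empty
  choose σ hσ using V.exists_singleton
  have hdef : DefinablePred₂ L fun x y => y = σ x :=
    DefinablePred.congr V.definable_isSingleton.app₂ fun w =>
      ⟨fun h => h ▸ hσ _, fun h => V.ext h.1 (hσ _).1 fun z => (h.2 z).trans ((hσ _).2 z).symm⟩
  obtain ⟨X, heX, hσX, hX⟩ := U.exists_orbit hinf e hdef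
  obtain ⟨W, hSW, hW⟩ := U.exists_isSuccSet ⟨X, U.isSet_of_mem heX, fun _ => .rfl⟩
  refine ⟨W, hSW, ?_⟩
  simp only [hW]
  refine ⟨⟨e, heS, he, heX⟩, fun n hn => ⟨σ n, hσ n, hσX n hn⟩, fun k hk => ?_⟩
  rcases hX k hk with rfl | ⟨n, hn, rfl⟩
  exacts [.inl ⟨heS, he⟩, .inr ⟨n, hσ n, hn⟩]

theorem not_isSuccSet_of_isSingletonCode (U : SetUniverse L E S) {f F : M}
    (h : IsSingletonCode E S f F) : ¬ IsSuccSet E S f := by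
  obtain ⟨⟨x, -, hF⟩, -, hf⟩ := h
  rintro ⟨y, -, hy⟩
  obtain rfl : y = F := (hf y).1 hy.mem_self
  obtain rfl : x = y := (hf x).1 ((hy.2 x).2 (.inl hF.mem_self))
  exact U.mem_irrefl x hF.mem_self

theorem codedUniverse (U : SetUniverse L E S) (hinf : HasInductiveSet E S) :
    CodedUniverse L (SuccMem E S) (IsSuccSet E S) (IsSingletonCode E S) where
  toSetUniverse := U.succUniverse
  definable_code := .and U.definable_isSuccSet.app₁ U.definable_isSingleton.app₂
  exists_omega := U.exists_succOmega hinf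
  not_isSet_of_code := U.not_isSuccSet_of_isSingletonCode
  code_unique hF hG := (hG.2.2 _).1 ((hF.2.2 _).2 rfl)
  exists_code hF := (U.exists_singleton _).imp fun _ hf => ⟨hF, hf⟩
  not_transGen_of_code {f F} h hfF := U.not_transGen_self F <|
    .head ((h.2.2 F).2 rfl) (Relation.TransGen.mono (fun _ _ => SuccMem.mem) _ _ hfF)

end SetUniverse

end CodedUniverse

/-! ## The theory of sets and functions -/

section SetFunSemantics

universe w
variable {M : Type w} [LT.Structure M]

/-- `x` is a set, in a structure for the theory of sets and functions. -/
def TSet (x : M) : Prop := Structure.RelMap (L := LT) (n := 1) TRel.isSet ![x]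

/-- `f` is a function on the set `x`. -/
def TFun (f x : M) : Prop := Structure.RelMap (L := LT) (n := 2) TRel.isFun ![f, x]

/-- `a` is an element of `b`. -/
def TMem (a b : M) : Prop := Structure.RelMap (L := LT) (n := 2) TRel.mem ![a, b]

/-- `f : a ↠ b` -/
def TOnto (f a b : M) : Prop := Structure.RelMap (L := LT) (n := 3) TRel.onto ![f, a, b]

/-- `f : a ↦ b` -/
def TMaps (f a b : M) : Prop := Structure.RelMap (L := LT) (n := 3) TRel.maps ![f, a, b]

variable (M) in
/-- The value of `∅`. -/
def tEmp : M := Structure.funMap (L := LT) (n := 0) TFunc.empty ![]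

variable (M) in
/-- The value of `ω`. -/
def tOmg : M := Structure.funMap (L := LT) (n := 0) TFunc.omega ![]

variable (M) in
/-- The value of `1_∅`. -/
def tOne : M := Structure.funMap (L := LT) (n := 0) TFunc.inactive ![]

/-- The value of `x⁺`. -/
def tPlus (x : M) : M := Structure.funMap (L := LT) (n := 1) TFunc.plus ![x]

variable {α : Type} {n : ℕ} {v : α → M} {xs : Fin n → M}

@[simp] theorem realize_emp : (emp : LT.Term (α ⊕ Fin n)).realize (Sum.elim v xs) = tEmp M :=
  Term.realize_constants (L := LT) (c := TFunc.empty)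

@[simp] theorem realize_omg : (omg : LT.Term (α ⊕ Fin n)).realize (Sum.elim v xs) = tOmg M :=
  Term.realize_constants (L := LT) (c := TFunc.omega)

@[simp] theorem realize_one : (one : LT.Term (α ⊕ Fin n)).realize (Sum.elim v xs) = tOne M :=
  Term.realize_constants (L := LT) (c := TFunc.inactive)

@[simp] theorem realize_plus {t : LT.Term (α ⊕ Fin n)} :
    (plus t).realize (Sum.elim v xs) = tPlus (t.realize (Sum.elim v xs)) :=
  Term.realize_functions_apply₁ (L := LT) (f := TFunc.plus)

@[simp] theorem realize_isSet {t : LT.Term (α ⊕ Fin n)} :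
    (isSet t).Realize v xs ↔ TSet (t.realize (Sum.elim v xs)) :=
  BoundedFormula.realize_rel₁ (L := LT) (R := TRel.isSet)

@[simp] theorem realize_isFun {s t : LT.Term (α ⊕ Fin n)} : (isFun s t).Realize v xs ↔
    TFun (s.realize (Sum.elim v xs)) (t.realize (Sum.elim v xs)) :=
  BoundedFormula.realize_rel₂ (L := LT) (R := TRel.isFun)

@[simp] theorem realize_tmem {s t : LT.Term (α ⊕ Fin n)} : (tmem s t).Realize v xs ↔
    TMem (s.realize (Sum.elim v xs)) (t.realize (Sum.elim v xs)) :=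
  BoundedFormula.realize_rel₂ (L := LT) (R := TRel.mem)

@[simp] theorem realize_onto {f s t : LT.Term (α ⊕ Fin n)} : (onto f s t).Realize v xs ↔
    TOnto (f.realize (Sum.elim v xs)) (s.realize (Sum.elim v xs)) (t.realize (Sum.elim v xs)) :=
  iff_of_eq (congrArg (Structure.RelMap (L := LT) (n := 3) TRel.onto)
    (FinVec.map_eq (Term.realize (Sum.elim v xs)) ![f, s, t]).symm)

@[simp] theorem realize_maps {f s t : LT.Term (α ⊕ Fin n)} : (maps f s t).Realize v xs ↔
    TMaps (f.realize (Sum.elim v xs)) (s.realize (Sum.elim v xs)) (t.realize (Sum.elim v xs)) :=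
  iff_of_eq (congrArg (Structure.RelMap (L := LT) (n := 3) TRel.maps)
    (FinVec.map_eq (Term.realize (Sum.elim v xs)) ![f, s, t]).symm)

@[simp] theorem realize_up {t : LT.Term (α ⊕ Fin n)} {a : M} :
    (up t).realize (Sum.elim v (Fin.snoc xs a)) = t.realize (Sum.elim v xs) := by
  rw [up, Term.realize_relabel, Sum.elim_comp_map, Function.comp_id, Fin.snoc_comp_castSucc]

@[simp] theorem realize_new {a : M} :
    (new : LT.Term (α ⊕ Fin (n + 1))).realize (Sum.elim v (Fin.snoc xs a)) = a := by
  rw [new, Term.realize_var, Sum.elim_inr, Fin.snoc_last]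

@[simp] theorem realize_allSet {φ : LT.BoundedFormula α (n + 1)} : (allSet φ).Realize v xs ↔
    ∀ x : M, TSet x → φ.Realize v (Fin.snoc xs x) := by
  simp only [allSet, BoundedFormula.realize_all, BoundedFormula.realize_imp, realize_isSet,
    realize_new]

@[simp] theorem realize_exSet {φ : LT.BoundedFormula α (n + 1)} : (exSet φ).Realize v xs ↔
    ∃ x : M, TSet x ∧ φ.Realize v (Fin.snoc xs x) := by
  simp only [exSet, BoundedFormula.realize_ex, BoundedFormula.realize_inf, realize_isSet,
    realize_new]

variable {t : LT.Term (α ⊕ Fin n)} {φ : LT.BoundedFormula α (n + 1)}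

@[simp] theorem realize_allFun : (allFun t φ).Realize v xs ↔
    ∀ f : M, TFun f (t.realize (Sum.elim v xs)) → φ.Realize v (Fin.snoc xs f) := by
  simp only [allFun, BoundedFormula.realize_all, BoundedFormula.realize_imp, realize_isFun,
    realize_new, realize_up]

@[simp] theorem realize_exFun : (exFun t φ).Realize v xs ↔
    ∃ f : M, TFun f (t.realize (Sum.elim v xs)) ∧ φ.Realize v (Fin.snoc xs f) := by
  simp only [exFun, BoundedFormula.realize_ex, BoundedFormula.realize_inf, realize_isFun,
    realize_new, realize_up]

@[simp] theorem realize_allIn : (allIn t φ).Realize v xs ↔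
    ∀ x : M, TMem x (t.realize (Sum.elim v xs)) → φ.Realize v (Fin.snoc xs x) := by
  simp only [allIn, BoundedFormula.realize_all, BoundedFormula.realize_imp, realize_tmem,
    realize_new, realize_up]

@[simp] theorem realize_exIn : (exIn t φ).Realize v xs ↔
    ∃ x : M, TMem x (t.realize (Sum.elim v xs)) ∧ φ.Realize v (Fin.snoc xs x) := by
  simp only [exIn, BoundedFormula.realize_ex, BoundedFormula.realize_inf, realize_tmem,
    realize_new, realize_up]

@[simp] theorem realize_isPair {p a b : LT.Term (α ⊕ Fin n)} : (isPair p a b).Realize v xs ↔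
    IsPair TMem TSet (p.realize (Sum.elim v xs)) (a.realize (Sum.elim v xs))
      (b.realize (Sum.elim v xs)) := by
  simp only [isPair, IsPair, BoundedFormula.realize_inf, BoundedFormula.realize_all,
    BoundedFormula.realize_iff, BoundedFormula.realize_sup, BoundedFormula.realize_bdEqual,
    realize_tmem, realize_isSet, realize_new, realize_up]

@[simp] theorem realize_isTuple {p a b : LT.Term (α ⊕ Fin n)} : (isTuple p a b).Realize v xs ↔
    IsTuple TMem TSet (p.realize (Sum.elim v xs)) (a.realize (Sum.elim v xs))
      (b.realize (Sum.elim v xs)) := by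
  simp only [isTuple, IsTuple, BoundedFormula.realize_ex, BoundedFormula.realize_inf,
    realize_isPair, realize_new, realize_up]

@[simp] theorem realize_tupleMem {a b f : LT.Term (α ⊕ Fin n)} : (tupleMem a b f).Realize v xs ↔
    TupleMem TMem TSet (a.realize (Sum.elim v xs)) (b.realize (Sum.elim v xs))
      (f.realize (Sum.elim v xs)) := by
  simp only [tupleMem, TupleMem, BoundedFormula.realize_ex, BoundedFormula.realize_inf,
    realize_isTuple, realize_tmem, realize_new, realize_up]

/-- `f` is the graph of a function from `x` to `y`, for a membership relation `E` and a sort of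
sets `S`. -/
def IsGraph (E : M → M → Prop) (S : M → Prop) (f x y : M) : Prop :=
  (∀ p, E p f → ∃ a, E a x ∧ ∃ b, E b y ∧ IsTuple E S p a b) ∧
    ∀ a, E a x → ∃! b, TupleMem E S a b f

@[simp] theorem realize_isGraph {f s t : LT.Term (α ⊕ Fin n)} : (isGraph f s t).Realize v xs ↔
    IsGraph TMem TSet (f.realize (Sum.elim v xs)) (s.realize (Sum.elim v xs))
      (t.realize (Sum.elim v xs)) := by
  simp only [isGraph, IsGraph, ExistsUnique, BoundedFormula.realize_inf, realize_allIn,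
    realize_exIn, BoundedFormula.realize_ex, BoundedFormula.realize_all,
    BoundedFormula.realize_imp, BoundedFormula.realize_bdEqual, realize_isTuple,
    realize_tupleMem, realize_new, realize_up]

end SetFunSemantics

section FunctionUniverse

universe w
variable {L : FirstOrder.Language.{0, 0}} {M : Type w} [L.Structure M] [LT.Structure M]

variable (L M) in
/-- The structure of the theory of sets and functions on `M` is a universe of sets together with a
definable relation `TMaps` for which every thing that is not a set is a function on its domain and
onto its range. A set bounds the domain and the range of each function, and every single-valued set
of two-tuples has a function with the same values. -/
structure FunctionUniverse : Prop extends SetUniverse L (TMem (M := M)) TSet where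
  definable_maps : DefinablePred₃ L (TMaps (M := M))
  isFun_iff : ∀ {f x : M}, TFun f x ↔ ¬ TSet f ∧ TSet x ∧ ∀ a, TMem a x ↔ ∃ b, TMaps f a b
  onto_iff : ∀ {f x y : M}, TOnto f x y ↔ TFun f x ∧ TSet y ∧ ∀ b, TMem b y ↔ ∃ a, TMaps f a b
  not_isSet_of_maps : ∀ {f a b : M}, TMaps f a b → ¬ TSet f
  maps_right_unique : ∀ {f a b c : M}, TMaps f a b → TMaps f a c → b = c
  not_maps_self : ∀ f a : M, ¬ TMaps f f a ∧ ¬ TMaps f a f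
  exists_field : ∀ f : M, ∃ y, ∀ {a b}, TMaps f a b → TMem a y ∧ TMem b y
  exists_of_graph : ∀ F : M, TSet F →
    (∀ a b c, TupleMem TMem TSet a b F → TupleMem TMem TSet a c F → b = c) →
    ∃ f, ¬ TSet f ∧ ∀ a b, TMaps f a b ↔ TupleMem TMem TSet a b F
  isSet_emp : TSet (tEmp M)
  not_mem_emp : ∀ a, ¬ TMem a (tEmp M)
  plus_isSingleton : ∀ a : M, IsSingleton TMem TSet (tPlus a) a
  isFun_one : TFun (tOne M) (tEmp M)
  isSet_omg : TSet (tOmg M)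
  emp_mem_omg : TMem (tEmp M) (tOmg M)
  plus_mem_omg : ∀ {a}, TMem a (tOmg M) → TMem (tPlus a) (tOmg M)
  eq_emp_or_plus : ∀ {b}, TMem b (tOmg M) → b = tEmp M ∨ ∃ a, TMem a (tOmg M) ∧ b = tPlus a

namespace FunctionUniverse

theorem eq_emp_iff (U : FunctionUniverse L M) {x : M} (hx : TSet x) :
    x = tEmp M ↔ ∀ a, ¬ TMem a x := by
  refine ⟨fun h => h ▸ U.not_mem_emp, fun h => U.ext hx U.isSet_emp fun a => ?_⟩
  exact iff_of_false (h a) (U.not_mem_emp a)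

theorem eq_plus_iff (U : FunctionUniverse L M) {a b : M} :
    b = tPlus a ↔ IsSingleton TMem TSet b a := by
  have ha := U.plus_isSingleton a
  exact ⟨fun h => h ▸ ha, fun hb => U.ext hb.1 ha.1 fun c => (hb.2 c).trans (ha.2 c).symm⟩

theorem isFun_unique (U : FunctionUniverse L M) {f x y : M} (hx : TFun f x) (hy : TFun f y) :
    x = y := by
  obtain ⟨-, hxS, hfx⟩ := U.isFun_iff.1 hx
  obtain ⟨-, hyS, hfy⟩ := U.isFun_iff.1 hy
  exact U.ext hxS hyS fun a => (hfx a).trans (hfy a).symm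

theorem mem_domain (U : FunctionUniverse L M) {f x a b : M} (hf : TFun f x) (hab : TMaps f a b) :
    TMem a x :=
  ((U.isFun_iff.1 hf).2.2 a).2 ⟨b, hab⟩

theorem exists_domain (U : FunctionUniverse L M) {f : M} (hf : ¬ TSet f) :
    ∃ x, TSet x ∧ TFun f x := by
  obtain ⟨y, hy⟩ := U.exists_field f
  obtain ⟨x, hxS, hx⟩ := U.separation (P := fun a => ∃ b, TMaps f a b)
    (.ex U.definable_maps.app₃) y
  refine ⟨x, hxS, U.isFun_iff.2 ⟨hf, hxS, fun a => (hx a).trans (and_iff_right_of_imp ?_)⟩⟩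
  exact fun ⟨_, hab⟩ => (hy hab).1

theorem exists_range (U : FunctionUniverse L M) {f x : M} (hf : TFun f x) :
    ∃ z, TSet z ∧ TOnto f x z := by
  obtain ⟨y, hy⟩ := U.exists_field f
  obtain ⟨z, hzS, hz⟩ := U.separation (P := fun b => ∃ a, TMaps f a b)
    (.ex U.definable_maps.app₃) y
  refine ⟨z, hzS, U.onto_iff.2 ⟨hf, hzS, fun b => (hz b).trans (and_iff_right_of_imp ?_)⟩⟩
  exact fun ⟨_, hab⟩ => (hy hab).2

theorem exists_identity (U : FunctionUniverse L M) {x : M} (hx : TSet x) : ∃ f : M, TFun f x := by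
  obtain ⟨F, hFS, hF⟩ := U.replacement (R := fun a p => IsTuple TMem TSet p a a)
    U.definable_isTuple.app₃ x fun a _ =>
      (U.exists_tuple a a).imp fun p hp => ⟨hp, fun p' hp' => U.isTuple_unique hp' hp⟩
  have hdiag {a b : M} (h : TupleMem TMem TSet a b F) : TMem a x ∧ a = b := by
    obtain ⟨p, hp, hpF⟩ := h
    obtain ⟨c, hc, hpc⟩ := (hF p).1 hpF
    obtain ⟨rfl, rfl⟩ := U.isTuple_inj hp hpc
    exact ⟨hc, rfl⟩
  obtain ⟨f, hf, hmaps⟩ := U.exists_of_graph F hFS fun a b c hb hc =>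
    (hdiag hb).2.symm.trans (hdiag hc).2
  refine ⟨f, U.isFun_iff.2 ⟨hf, hx, fun a => ⟨fun ha => ?_, fun ⟨b, hab⟩ => ?_⟩⟩⟩
  · obtain ⟨p, hp⟩ := U.exists_tuple a a
    exact ⟨a, (hmaps a a).2 ⟨p, hp, (hF p).2 ⟨a, ha, hp⟩⟩⟩
  · exact (hdiag ((hmaps a b).1 hab)).1

theorem exists_mapsTo (U : FunctionUniverse L M) (a b : M) :
    ∃ f : M, ¬ TSet f ∧ ∀ a' b', TMaps f a' b' ↔ a' = a ∧ b' = b := by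
  obtain ⟨p, hp⟩ := U.exists_tuple a b
  obtain ⟨F, hFS, hF⟩ := U.exists_singleton p
  have htuple (a' b' : M) : TupleMem TMem TSet a' b' F ↔ a' = a ∧ b' = b := by
    simp only [TupleMem, hF, exists_eq_right]
    exact ⟨fun h => U.isTuple_inj h hp, fun ⟨ha, hb⟩ => ha ▸ hb ▸ hp⟩
  simpa only [htuple] using U.exists_of_graph F hFS fun a' b' c hb hc =>
    ((htuple a' b').1 hb).2.trans ((htuple a' c).1 hc).2.symm

theorem exists_isFun_of_isGraph (U : FunctionUniverse L M) {F x y : M} (hF : TSet F) (hx : TSet x)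
    (hg : IsGraph TMem TSet F x y) :
    ∃ f, TFun f x ∧ ∀ a b, TMaps f a b ↔ TupleMem TMem TSet a b F := by
  have hdom {a b : M} (h : TupleMem TMem TSet a b F) : TMem a x := by
    obtain ⟨p, hp, hpF⟩ := h
    obtain ⟨a', ha', b', -, hp'⟩ := hg.1 p hpF
    rwa [(U.isTuple_inj hp hp').1]
  obtain ⟨f, hf, hmaps⟩ := U.exists_of_graph F hF fun a b c hb hc =>
    (hg.2 a (hdom hb)).unique hb hc
  refine ⟨f, U.isFun_iff.2 ⟨hf, hx, fun a => ?_⟩, hmaps⟩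
  simp only [hmaps]
  exact ⟨fun ha => (hg.2 a ha).exists, fun ⟨_, hb⟩ => hdom hb⟩

theorem definableFun_funMap (U : FunctionUniverse L M) :
    ∀ {n} (f : LT.Functions n), (Set.univ : Set M).DefinableFun L (Structure.funMap f)
  | _, .empty | _, .omega | _, .inactive => definableFun_of_isEmpty _
  | _, .plus => by
    refine DefinablePred.congr
      (P := fun v : Option (Fin 1) → M => IsSingleton TMem TSet (v none) (v (some 0)))
      U.definable_isSingleton.app₂ fun v => ?_
    rw [← U.eq_plus_iff, eq_comm, tPlus, ← FinVec.etaExpand_eq (v ∘ some)]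
    rfl

theorem definablePred_relMap (U : FunctionUniverse L M) {n : ℕ} (R : LT.Relations n) :
    DefinablePred L fun xs : Fin n → M => Structure.RelMap R xs := by
  have hfun : DefinablePred₂ L (TFun (M := M)) :=
    .congr (.and U.definable_isSet.app₁.not (.and U.definable_isSet.app₁
      (.all (.iff U.definable_mem.app₂ (.ex U.definable_maps.app₃))))) fun _ => U.isFun_iff
  have honto : DefinablePred₃ L (TOnto (M := M)) :=
    .congr (.and hfun.app₂ (.and U.definable_isSet.app₁
      (.all (.iff U.definable_mem.app₂ (.ex U.definable_maps.app₃))))) fun _ => U.onto_iff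
  have heta {n : ℕ} (R : LT.Relations n) (xs : Fin n → M) :
      Structure.RelMap R xs ↔ Structure.RelMap R (FinVec.etaExpand xs) := by
    rw [FinVec.etaExpand_eq]
  cases R with
  | isSet => exact U.definable_isSet.congr (heta TRel.isSet)
  | isFun => exact hfun.congr (heta TRel.isFun)
  | mem => exact U.definable_mem.congr (heta TRel.mem)
  | onto => exact honto.congr (heta TRel.onto)
  | maps => exact U.definable_maps.congr (heta TRel.maps)

theorem definable_realize (U : FunctionUniverse L M) {m d : ℕ} (φ : LT.Formula (Fin m ⊕ Fin d))
    (p : Fin m → M) : DefinablePred L fun w : Fin d → M => φ.Realize (Sum.elim p w) := by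
  refine (definablePred_realize U.definableFun_funMap U.definablePred_relMap φ).comp
    (F := fun w => Sum.elim p w) ?_
  rintro (i | i)
  · exact definableFun_const (p i)
  · exact Set.DefinableFun.proj L

theorem models_sortThing (U : FunctionUniverse L M) : M ⊨ sortThing := by
  have h (x : M) : TSet x ∨ ∃ y, TSet y ∧ TFun x y := or_iff_not_imp_left.2 U.exists_domain
  simpa [sortThing, Sentence.Realize, Formula.Realize, Fin.snoc] using h

theorem models_sortFun (U : FunctionUniverse L M) : M ⊨ sortFun := by
  have h (f x : M) (hf : TFun f x) : TSet x := (U.isFun_iff.1 hf).2.1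
  simpa [sortFun, Sentence.Realize, Formula.Realize, Fin.snoc] using h

theorem models_sortNonempty (U : FunctionUniverse L M) : M ⊨ sortNonempty := by
  have h (x : M) (hx : TSet x) : ∃ f : M, TFun f x := U.exists_identity hx
  simpa [sortNonempty, Sentence.Realize, Formula.Realize, Fin.snoc] using h

theorem models_axExt (U : FunctionUniverse L M) : M ⊨ axExt := by
  have h (x : M) (hx : TSet x) (y : M) (hy : TSet y) : x = y ↔ ∀ z, TMem z x ↔ TMem z y :=
    ⟨fun h _ => h ▸ .rfl, U.ext hx hy⟩
  simpa [axExt, Sentence.Realize, Formula.Realize, Fin.snoc] using h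

theorem models_axFunNotSet (U : FunctionUniverse L M) : M ⊨ axFunNotSet := by
  have h (x : M) (_ : TSet x) (f : M) (hf : TFun f x) (y : M) (hy : TSet y) : f ≠ y :=
    fun hfy => (U.isFun_iff.1 hf).1 (hfy ▸ hy)
  simpa [axFunNotSet, Sentence.Realize, Formula.Realize, Fin.snoc] using h

theorem models_axSetNotFun (U : FunctionUniverse L M) : M ⊨ axSetNotFun := by
  have h (x : M) (hx : TSet x) (a b : M) : ¬ TOnto x a b ∧ ¬ TMaps x a b :=
    ⟨fun ho => (U.isFun_iff.1 (U.onto_iff.1 ho).1).1 hx, fun hm => U.not_isSet_of_maps hm hx⟩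
  simpa [axSetNotFun, Sentence.Realize, Formula.Realize, Fin.snoc] using h

theorem models_axEmpty (U : FunctionUniverse L M) : M ⊨ axEmpty := by
  have h : TSet (tEmp M) ∧ ∀ a, ¬ TMem a (tEmp M) := ⟨U.isSet_emp, U.not_mem_emp⟩
  simpa [axEmpty, Sentence.Realize, Formula.Realize, Fin.snoc] using h

theorem models_axPair (U : FunctionUniverse L M) : M ⊨ axPair := by
  simpa [axPair, Sentence.Realize, Formula.Realize, Fin.snoc] using U.pair

theorem models_axUnion (U : FunctionUniverse L M) : M ⊨ axUnion := by
  have h (x : M) (_ : TSet x) :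
      ∃ y, TSet y ∧ ∀ a, TMem a y ↔ ∃ z, TSet z ∧ TMem z x ∧ TMem a z := by
    refine (U.union x).imp fun y hy => ⟨hy.1, fun a => (hy.2 a).trans (exists_congr fun z => ?_)⟩
    exact (and_iff_right_of_imp fun hz => U.isSet_of_mem hz.2).symm
  simpa [axUnion, Sentence.Realize, Formula.Realize, Fin.snoc] using h

theorem models_axPower (U : FunctionUniverse L M) : M ⊨ axPower := by
  have h (x : M) (_ : TSet x) :
      ∃ y, TSet y ∧ ∀ a, TMem a y ↔ ∃ z, TSet z ∧ (∀ w, TMem w z → TMem w x) ∧ a = z := by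
    simpa only [← and_assoc, exists_eq_right'] using U.power x
  simpa [axPower, Sentence.Realize, Formula.Realize, Fin.snoc] using h

theorem models_axRegularity (U : FunctionUniverse L M) : M ⊨ axRegularity := by
  have h (x : M) (hx : TSet x) (hne : x ≠ tEmp M) :
      ∃ a, TMem a x ∧ ∀ b, TMem b a → ¬ TMem b x :=
    U.regularity x (not_forall_not.1 (mt (U.eq_emp_iff hx).2 hne))
  simpa [axRegularity, Sentence.Realize, Formula.Realize, Fin.snoc] using h

theorem models_axInfinity (U : FunctionUniverse L M) : M ⊨ axInfinity := by
  have hemp (b : M) (hb : TMem b (tOmg M)) :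
      (¬ ∃ a, TMem a (tOmg M) ∧ b = tPlus a) ↔ b = tEmp M := by
    refine ⟨(U.eq_emp_or_plus hb).resolve_right, ?_⟩
    rintro rfl ⟨a, -, ha⟩
    exact U.not_mem_emp a (((U.eq_plus_iff.1 ha).2 a).2 rfl)
  have h : TSet (tOmg M) ∧ TMem (tEmp M) (tOmg M) ∧
      (∀ a, TMem a (tOmg M) → TMem (tPlus a) (tOmg M)) ∧
      ∀ b, TMem b (tOmg M) → ((¬ ∃ a, TMem a (tOmg M) ∧ b = tPlus a) ↔ b = tEmp M) :=
    ⟨U.isSet_omg, U.emp_mem_omg, fun _ => U.plus_mem_omg, hemp⟩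
  simpa [axInfinity, Sentence.Realize, Formula.Realize, Fin.snoc, and_assoc] using h

theorem models_axPlus (U : FunctionUniverse L M) : M ⊨ axPlus := by
  have h (a b : M) : b = tPlus a ↔ ∃ x, TSet x ∧ b = x ∧ ∀ c, TMem c x ↔ c = a := by
    simp only [U.eq_plus_iff, IsSingleton, and_left_comm, exists_eq_left']
  simpa [axPlus, Sentence.Realize, Formula.Realize, Fin.snoc] using h

theorem models_axFunNoElem (U : FunctionUniverse L M) : M ⊨ axFunNoElem := by
  have h (x : M) (_ : TSet x) (f : M) (hf : TFun f x) (a : M) : ¬ TMem a f :=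
    fun ha => (U.isFun_iff.1 hf).1 (U.isSet_of_mem ha)
  simpa [axFunNoElem, Sentence.Realize, Formula.Realize, Fin.snoc] using h

theorem models_axFunTotal (U : FunctionUniverse L M) : M ⊨ axFunTotal := by
  have h (x : M) (hx : TSet x) (f : M) (hf : TFun f x) (_ : x ≠ tEmp M) :
      ∃ y, TSet y ∧ ∃ z, TSet z ∧ TOnto f y z ∧
        ∀ a, TMem a y → ∃ b, TMaps f a b ∧ ∀ b', TMaps f a b' → b' = b := by
    obtain ⟨z, hz, hfz⟩ := U.exists_range hf
    refine ⟨x, hx, z, hz, hfz, fun a ha => ?_⟩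
    obtain ⟨b, hab⟩ := ((U.isFun_iff.1 hf).2.2 a).1 ha
    exact ⟨b, hab, fun b' hab' => U.maps_right_unique hab' hab⟩
  simpa [axFunTotal, Sentence.Realize, Formula.Realize, Fin.snoc] using h

theorem models_axFunDomain (U : FunctionUniverse L M) : M ⊨ axFunDomain := by
  have h (x : M) (_ : TSet x) (f : M) (hf : TFun f x) (a : M) (ha : a ≠ x) (b : M) :
      ¬ TOnto f a b :=
    fun hab => ha (U.isFun_unique (U.onto_iff.1 hab).1 hf)
  simpa [axFunDomain, Sentence.Realize, Formula.Realize, Fin.snoc] using h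

theorem models_axFunOutside (U : FunctionUniverse L M) : M ⊨ axFunOutside := by
  have h (x : M) (_ : TSet x) (f : M) (hf : TFun f x) (a : M) (ha : ¬ TMem a x) (b : M) :
      ¬ TMaps f a b :=
    fun hab => ha (U.mem_domain hf hab)
  simpa [axFunOutside, Sentence.Realize, Formula.Realize, Fin.snoc] using h

theorem models_axFunRange (U : FunctionUniverse L M) : M ⊨ axFunRange := by
  have h (x : M) (_ : TSet x) (f : M) (hf : TFun f x) (_ : x ≠ tEmp M) (b : M)
      (hb : TOnto f x b) :
      ∃ z, TSet z ∧ b = z ∧ ∀ c, TMem c z ↔ ∃ a, TMem a x ∧ TMaps f a c := by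
    obtain ⟨-, hbS, hfb⟩ := U.onto_iff.1 hb
    refine ⟨b, hbS, rfl, fun c => (hfb c).trans (exists_congr fun a => ?_)⟩
    exact (and_iff_right_of_imp (U.mem_domain hf)).symm
  simpa [axFunRange, Sentence.Realize, Formula.Realize, Fin.snoc] using h

theorem models_axFunPreimage (U : FunctionUniverse L M) : M ⊨ axFunPreimage := by
  have h (x : M) (_ : TSet x) (_ : x ≠ tEmp M) (f : M) (_ : TFun f x) (y : M) (_ : TSet y)
      (_ : TOnto f x y) (b : M) : ∃ z, TSet z ∧ ∀ a, TMem a z ↔ TMem a x ∧ TMaps f a b :=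
    U.separation (P := fun a => TMaps f a b) U.definable_maps.app₃ x
  simpa [axFunPreimage, Sentence.Realize, Formula.Realize, Fin.snoc] using h

theorem models_axInactive (U : FunctionUniverse L M) : M ⊨ axInactive := by
  have hmaps (a b : M) : ¬ TMaps (tOne M) a b :=
    fun hab => U.not_mem_emp a (U.mem_domain U.isFun_one hab)
  have honto : TOnto (tOne M) (tEmp M) (tEmp M) := U.onto_iff.2
    ⟨U.isFun_one, U.isSet_emp, fun b => iff_of_false (U.not_mem_emp b) fun ⟨a, h⟩ => hmaps a b h⟩
  have h := And.intro U.isFun_one (And.intro honto hmaps)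
  simpa [axInactive, Sentence.Realize, Formula.Realize, Fin.snoc] using h

theorem models_axUrFunction (U : FunctionUniverse L M) : M ⊨ axUrFunction := by
  have h (a b : M) :
      ∃ f, TFun f (tPlus a) ∧ TOnto f (tPlus a) (tPlus b) ∧ TMaps f a b := by
    obtain ⟨haS, ha⟩ := U.plus_isSingleton a
    obtain ⟨hbS, hb⟩ := U.plus_isSingleton b
    obtain ⟨f, hf, hmaps⟩ := U.exists_mapsTo a b
    have hfun : TFun f (tPlus a) := U.isFun_iff.2 ⟨hf, haS, fun c => by simp [ha, hmaps]⟩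
    exact ⟨f, hfun, U.onto_iff.2 ⟨hfun, hbS, fun c => by simp [hb, hmaps]⟩,
      (hmaps a b).2 ⟨rfl, rfl⟩⟩
  simpa [axUrFunction, Sentence.Realize, Formula.Realize, Fin.snoc] using h

theorem models_axFunRegularity (U : FunctionUniverse L M) : M ⊨ axFunRegularity := by
  have h (x : M) (_ : TSet x) (f : M) (_ : TFun f x) (y : M) (_ : TSet y) (_ : TOnto f x y)
      (a : M) : ¬ TMaps f f a ∧ ¬ TMaps f a f :=
    U.not_maps_self f a
  simpa [axFunRegularity, Sentence.Realize, Formula.Realize, Fin.snoc] using h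

theorem models_separation (U : FunctionUniverse L M) {m : ℕ} (φ : LT.Formula (Fin m ⊕ Fin 1)) :
    M ⊨ separation φ := by
  refine realize_closure.2 fun p => ?_
  have h (x : M) (_ : TSet x) :
      ∃ y, TSet y ∧ ∀ a, TMem a y ↔ TMem a x ∧ φ.Realize (Sum.elim p ![a]) :=
    U.separation (.congr (U.definable_realize φ p) fun w => by
      rw [← FinVec.etaExpand_eq w]
      rfl) x
  simpa [Formula.Realize, Fin.snoc, realize_at'_one] using h

theorem models_replacement (U : FunctionUniverse L M) {m : ℕ} (φ : LT.Formula (Fin m ⊕ Fin 2)) :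
    M ⊨ replacement φ := by
  refine realize_closure.2 fun p => ?_
  have h (x : M) (_ : TSet x) (hx : ∀ a, TMem a x → ∃! b, φ.Realize (Sum.elim p ![a, b])) :
      ∃ z, TSet z ∧ ∀ c, TMem c z ↔ ∃ a, TMem a x ∧ φ.Realize (Sum.elim p ![a, c]) :=
    U.replacement (.congr (U.definable_realize φ p) fun w => by
      rw [← FinVec.etaExpand_eq w]
      rfl) x hx
  simpa [Formula.Realize, Fin.snoc, realize_at'_two, ExistsUnique] using h

theorem models_reverseGraph (U : FunctionUniverse L M) : M ⊨ reverseGraph := by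
  have h (F : M) (hF : TSet F) (x : M) (hx : TSet x) (y : M) (_ : TSet y)
      (hg : IsGraph TMem TSet F x y) :
      ∃ f, TFun f x ∧ ∀ a b, TMaps f a b ↔ TupleMem TMem TSet a b F :=
    U.exists_isFun_of_isGraph hF hx hg
  simpa [reverseGraph, Sentence.Realize, Formula.Realize, Fin.snoc] using h

theorem models_tInfty0 (U : FunctionUniverse L M) : M ⊨ TInfty0 := by
  refine ⟨?_⟩
  rintro σ (((((hσ | hσ) | hσ) | ⟨m, φ, rfl⟩) | ⟨m, φ, rfl⟩) | rfl)
  · rcases hσ with rfl | rfl | rfl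
    exacts [U.models_sortThing, U.models_sortFun, U.models_sortNonempty]
  · rcases hσ with rfl | rfl | rfl | rfl | rfl | rfl | rfl | rfl | rfl | rfl
    exacts [U.models_axExt, U.models_axFunNotSet, U.models_axSetNotFun, U.models_axEmpty,
      U.models_axPair, U.models_axUnion, U.models_axPower, U.models_axRegularity,
      U.models_axInfinity, U.models_axPlus]
  · rcases hσ with rfl | rfl | rfl | rfl | rfl | rfl | rfl | rfl | rfl
    exacts [U.models_axFunNoElem, U.models_axFunTotal, U.models_axFunDomain,
      U.models_axFunOutside, U.models_axFunRange, U.models_axFunPreimage, U.models_axInactive,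
      U.models_axUrFunction, U.models_axFunRegularity]
  exacts [U.models_separation φ, U.models_replacement φ, U.models_reverseGraph]

end FunctionUniverse

end FunctionUniverse

section CodedStructure

universe w
variable {L : FirstOrder.Language.{0, 0}} {M : Type w} [L.Structure M] {E : M → M → Prop}
  {S : M → Prop} {C : M → M → Prop}

/-- No two tuples in `F` have the same first component. -/
def Functional (E : M → M → Prop) (S : M → Prop) (F : M) : Prop :=
  ∀ a b c, TupleMem E S a b F → TupleMem E S a c F → b = c

/-- `f : a ↦ b` in a coded universe: `f` is the code of a functional set containing `(a, b)`. -/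
def CodeMaps (E : M → M → Prop) (S : M → Prop) (C : M → M → Prop) (f a b : M) : Prop :=
  ∃ F, C f F ∧ Functional E S F ∧ TupleMem E S a b F

/-- `f` is a function on the set `x` in a coded universe. Things that are neither sets nor codes of
functional sets are functions on the empty set. -/
def CodeFun (E : M → M → Prop) (S : M → Prop) (C : M → M → Prop) (f x : M) : Prop :=
  ¬ S f ∧ S x ∧ ∀ a, E a x ↔ ∃ b, CodeMaps E S C f a b

/-- `f : x ↠ y` in a coded universe. -/
def CodeOnto (E : M → M → Prop) (S : M → Prop) (C : M → M → Prop) (f x y : M) : Prop :=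
  CodeFun E S C f x ∧ S y ∧ ∀ b, E b y ↔ ∃ a, CodeMaps E S C f a b

/-- The structure for the theory of sets and functions on a coded universe, with the given values
of `∅`, `ω`, `1_∅` and `(·)⁺`. -/
@[reducible] def codedStructure (E : M → M → Prop) (S : M → Prop) (C : M → M → Prop)
    (empty omega inactive : M) (plus : M → M) : LT.Structure M where
  funMap {n} F xs := match n, F, xs with
    | _, .empty, _ => empty
    | _, .omega, _ => omega
    | _, .inactive, _ => inactive
    | _, .plus, xs => plus (xs 0)
  RelMap {n} R xs := match n, R, xs with
    | _, .isSet, xs => S (xs 0)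
    | _, .isFun, xs => CodeFun E S C (xs 0) (xs 1)
    | _, .mem, xs => E (xs 0) (xs 1)
    | _, .onto, xs => CodeOnto E S C (xs 0) (xs 1) (xs 2)
    | _, .maps, xs => CodeMaps E S C (xs 0) (xs 1) (xs 2)

namespace CodedUniverse

theorem definable_codeMaps (U : CodedUniverse L E S C) : DefinablePred₃ L (CodeMaps E S C) := by
  have htuple := U.definable_tupleMem
  exact .ex (.and U.definable_code.app₂ (.and
    (.all (.all (.all (.imp htuple.app₃ (.imp htuple.app₃ .eq))))) htuple.app₃))

theorem codeMaps_right_unique (U : CodedUniverse L E S C) {f a b c : M}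
    (hb : CodeMaps E S C f a b) (hc : CodeMaps E S C f a c) : b = c := by
  obtain ⟨F, hF, hfun, hbF⟩ := hb
  obtain ⟨F', hF', -, hcF⟩ := hc
  obtain rfl := U.code_unique hF hF'
  exact hfun a b c hbF hcF

theorem not_codeMaps_self (U : CodedUniverse L E S C) (f a : M) :
    ¬ CodeMaps E S C f f a ∧ ¬ CodeMaps E S C f a f := by
  constructor
  · rintro ⟨F, hF, -, p, ⟨q, -, hp⟩, hpF⟩
    exact U.not_transGen_of_code hF (.tail (.single ((hp.2 f).2 (.inl rfl))) hpF)
  · rintro ⟨F, hF, -, p, ⟨q, hq, hp⟩, hpF⟩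
    have hfq : E f q := (hq.2 f).2 (.inr rfl)
    exact U.not_transGen_of_code hF (.tail (.tail (.single hfq) ((hp.2 q).2 (.inr rfl))) hpF)

theorem exists_field (U : CodedUniverse L E S C) (f : M) :
    ∃ y, ∀ {a b}, CodeMaps E S C f a b → E a y ∧ E b y := by
  by_cases hf : ∃ F, C f F
  · obtain ⟨F, hF⟩ := hf
    obtain ⟨u, -, hu⟩ := U.union F
    obtain ⟨y, -, hy⟩ := U.union u
    refine ⟨y, ?_⟩
    rintro a b ⟨F', hF', -, p, ⟨q, hq, hp⟩, hpF⟩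
    obtain rfl := U.code_unique hF hF'
    have hqu : E q u := (hu q).2 ⟨p, hpF, (hp.2 q).2 (.inr rfl)⟩
    exact ⟨(hy a).2 ⟨q, hqu, (hq.2 a).2 (.inl rfl)⟩, (hy b).2 ⟨q, hqu, (hq.2 b).2 (.inr rfl)⟩⟩
  · exact ⟨f, fun ⟨F, hF, _⟩ => absurd ⟨F, hF⟩ hf⟩

theorem exists_codeMaps_iff (U : CodedUniverse L E S C) {F : M} (hF : S F)
    (hfun : Functional E S F) :
    ∃ f, ¬ S f ∧ ∀ a b, CodeMaps E S C f a b ↔ TupleMem E S a b F := by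
  obtain ⟨f, hf⟩ := U.exists_code hF
  refine ⟨f, U.not_isSet_of_code hf, fun a b => ⟨?_, fun h => ⟨F, hf, hfun, h⟩⟩⟩
  rintro ⟨F', hF', -, h⟩
  rwa [U.code_unique hf hF']

theorem exists_codeFun_empty (U : CodedUniverse L E S C) {e : M} (he : S e) (he' : ∀ a, ¬ E a e) :
    ∃ f, CodeFun E S C f e := by
  have htuple (a b : M) : ¬ TupleMem E S a b e := fun ⟨p, _, hp⟩ => he' p hp
  obtain ⟨f, hf, hmaps⟩ := U.exists_codeMaps_iff he fun a b _ hb => absurd hb (htuple a b)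
  refine ⟨f, hf, he, fun a => iff_of_false (he' a) ?_⟩
  simp only [hmaps, htuple, exists_false, not_false_iff]

theorem exists_functionUniverse (U : CodedUniverse L E S C) :
    ∃ _ : LT.Structure M, FunctionUniverse L M := by
  obtain ⟨W, hW, ⟨e, he, he', heW⟩, hplus, hpred⟩ := U.exists_omega
  obtain ⟨i, hi⟩ := U.exists_codeFun_empty he he'
  choose σ hσ using U.exists_singleton
  have hsingleton {k n : M} (hk : IsSingleton E S k n) : k = σ n :=
    U.ext hk.1 (hσ n).1 fun z => (hk.2 z).trans ((hσ n).2 z).symm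
  refine ⟨codedStructure E S C e W i σ, @FunctionUniverse.mk _ _ _ (_) U.toSetUniverse
    U.definable_codeMaps .rfl .rfl ?_ U.codeMaps_right_unique U.not_codeMaps_self U.exists_field
    (fun F => U.exists_codeMaps_iff) he he' hσ hi hW heW ?_ ?_⟩
  · exact fun ⟨F, hF, _⟩ => U.not_isSet_of_code hF
  · intro n hn
    obtain ⟨k, hk, hkW⟩ := hplus n hn
    obtain rfl := hsingleton hk
    exact hkW
  · intro k hk
    refine (hpred k hk).imp (fun h => ?_) fun ⟨n, hkn, hn⟩ => ⟨n, hn, hsingleton hkn⟩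
    exact U.ext h.1 he fun z => iff_of_false (h.2 z) (he' z)

end CodedUniverse

end CodedStructure

section RelativeConsistency

instance : LZF.IsRelational := fun _ => inferInstanceAs (IsEmpty Empty)

instance : Countable LZF.Symbols := by
  have : Subsingleton (Σ l, LZF.Relations l) := ⟨by rintro ⟨_, ⟨⟩⟩ ⟨_, ⟨⟩⟩; rfl⟩
  exact inferInstanceAs (Countable ((Σ l, LZF.Functions l) ⊕ (Σ l, LZF.Relations l)))

end RelativeConsistency

end SetsAndFunctions

theorem mainTheorem2 :
    SetsAndFunctions.Consistent SetsAndFunctions.ZF →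
      SetsAndFunctions.Consistent SetsAndFunctions.TInfty0 := by
  intro hZF
  obtain ⟨M, _, _, hM⟩ := SetsAndFunctions.exists_model_of_consistent hZF
  have sets := SetsAndFunctions.setUniverse_of_models hM
  have coded := sets.codedUniverse (SetsAndFunctions.hasInductiveSet_of_models hM)
  obtain ⟨_, functions⟩ := coded.exists_functionUniverse
  exact SetsAndFunctions.consistent_of_model functions.models_tInfty0
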